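/- A hypergraph $H=(V(H),E(H),i_H)$ consists of finite sets $V(H)$ of vertices and $E(H)$ of edges and a map $i_H:E(H)\to 2^{V(H)}$ with $|i_H(e)|\ge 2$ for all $e$; parallel edges are allowed. The degree $d_H(v)$ is the number of edges $e$ with $v\in i_H(e)$; $\delta(H)$ and $\Delta(H)$ are the minimum and the maximum degree. For $X\subseteq V(H)$, the induced subhypergraph $H[X]$ has vertex set $X$ and all edges $e$ with $i_H(e)\subseteq X$, and $H-v=H[V(H)\setminus\{v\}]$; the hypergraph $H(X)$ obtained by shrinking $H$ to $X$ has vertex set $X$, the edges $e$ with $|i_H(e)\cap X|\ge 2$, and incidence function $e\mapsto i_H(e)\cap X$. A hypergraph is connected if it is non-empty and any two of its vertices are joined by a hyperpath, i.e. a sequence $(v_1,e_1,v_2,\dots,v_q,e_q,v_{q+1})$ of distinct vertices $v_j$ and distinct edges $e_j$ with $\{v_j,v_{j+1}\}\subseteq i_H(e_j)$ for $1\le j\le q$. A vertex $v$ of $H$ is separating if $H$ is the union of two induced subhypergraphs, each with at least two vertices, whose only common vertex is $v$. A block of $H$ is a maximal connected subhypergraph of $H$ that has no separating vertex. For a simple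 graph $G$ and $t\ge1$, $tG$ arises from $G$ by replacing each edge by $t$ parallel edges; $K_n$ and $C_n$ are the complete graph and the cycle of order $n$. A brick is a hypergraph isomorphic to $tK_n$ for some $t,n\ge 1$, or to $tC_n$ for some $t\ge 1$ and odd $n\ge 3$. A hypergraph property $\mathcal P$ (an isomorphism-closed class of hypergraphs) is smooth if it is closed under induced subhypergraphs, contains a non-empty hypergraph, and does not contain all hypergraphs. Let $\mathcal F(\mathcal P)$ be the class of all hypergraphs $H\notin\mathcal P$ such that $H-v\in\mathcal P$ for all $v\in V(H)$, and let $d(\mathcal P)=\min\{\delta(H): H\in\mathcal F(\mathcal P)\}$. Given a set $C$ and a list-assignment $L:V(H)\to 2^C$, a $(\mathcal P,L)$-coloring of $H$ is a map $\varphi:V(H)\to C$ with $\varphi(v)\in L(v)$ for all $v\in V(H)$ and $H[\varphi^{-1}(c)]\in\mathcal P$ for all $c\in C$. The hypergraph $H$ is $(\mathcal P,L)$-critical if $H$ has no $(\mathcal P,L)$-coloring, but $H-v$ has one (with respect to the restriction of $L$) for every $v\in V(H)$. Let $V(H,\mathcal P,L)=\{v\in V(H): d_H(v)=d(\mathcal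 P)\,|L(v)|\}$ be the set of low vertices. Theorem 1.3. Let $\mathcal P$ be a smooth hypergraph property with $d(\mathcal P)=r$, let $H$ be a non-empty hypergraph, and let $L$ be a list-assignment for $H$ such that $H$ is $(\mathcal P,L)$-critical and the low-vertex hypergraph $F=H(V(H,\mathcal P,L))$ is non-empty. If $B$ is a block of $F$, then - $B$ is a brick, or - $B\in\mathcal F(\mathcal P)$ and $B$ is $r$-regular (every vertex of $B$ has degree $r$ in $B$), or - $B\in\mathcal P$ and $\Delta(B)\le r$. -/

import Mathlib

universe u v w u' v'

/-- A finite hypergraph `(V, E, i)`: finite vertex and edge types and an incidence function that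
sends every edge to a set of at least two vertices.  Parallel edges are allowed, loops are not. -/
structure FinHypergraph where
  V : Type u
  E : Type v
  finite_V : Finite V
  finite_E : Finite E
  inc : E → Set V
  two_le_inc : ∀ e, 2 ≤ (inc e).ncard

namespace FinHypergraph

attribute [instance] finite_V finite_E

/-- Isomorphisms of hypergraphs (the two hypergraphs may live in different universes). -/
structure Iso (H : FinHypergraph.{u, v}) (H' : FinHypergraph.{u', v'}) where
  onV : H.V ≃ H'.V
  onE : H.E ≃ H'.E
  inc_eq : ∀ e, H'.inc (onE e) = onV '' H.inc e

/-- The number of edges incident to a vertex. -/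
noncomputable def degree (H : FinHypergraph.{u, v}) (x : H.V) : ℕ :=
  {e : H.E | x ∈ H.inc e}.ncard

/-- The minimum degree, with value `0` for the empty hypergraph. -/
noncomputable def minDegree (H : FinHypergraph.{u, v}) : ℕ := ⨅ x, H.degree x

/-- The maximum degree, with value `0` for the empty hypergraph. -/
noncomputable def maxDegree (H : FinHypergraph.{u, v}) : ℕ := ⨆ x, H.degree x

def IsRegular (H : FinHypergraph.{u, v}) (r : ℕ) : Prop :=
  Nonempty H.V ∧ ∀ x, H.degree x = r

/-- Subhypergraphs: a set of vertices and a set of edges all of whose ends are chosen vertices;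
the incidence function is the restricted one. -/
@[ext]
structure Sub (H : FinHypergraph.{u, v}) where
  verts : Set H.V
  edges : Set H.E
  inc_subset : ∀ e ∈ edges, H.inc e ⊆ verts

theorem ncard_preimage_val {α : Type u} (s X : Set α) :
    ((Subtype.val : X → α) ⁻¹' s).ncard = (s ∩ X).ncard := by
  rw [← Set.ncard_image_of_injective _ Subtype.val_injective, Subtype.image_preimage_coe,
    Set.inter_comm]

namespace Sub

instance (H : FinHypergraph.{u, v}) : LE H.Sub where
  le A B := A.verts ⊆ B.verts ∧ A.edges ⊆ B.edges

/-- A subhypergraph as a hypergraph in its own right. -/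
def coe {H : FinHypergraph.{u, v}} (A : H.Sub) : FinHypergraph.{u, v} where
  V := A.verts
  E := A.edges
  finite_V := inferInstance
  finite_E := inferInstance
  inc e := Subtype.val ⁻¹' H.inc e
  two_le_inc e := by
    rw [ncard_preimage_val, Set.inter_eq_left.2 (A.inc_subset e e.2)]
    exact H.two_le_inc e

end Sub

/-- `H[X]` as a subhypergraph of `H`: all edges contained in `X` are kept. -/
def inducedSub (H : FinHypergraph.{u, v}) (X : Set H.V) : H.Sub where
  verts := X
  edges := {e | H.inc e ⊆ X}
  inc_subset _ he := he

/-- The induced subhypergraph `H[X]`. -/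
abbrev induce (H : FinHypergraph.{u, v}) (X : Set H.V) : FinHypergraph.{u, v} :=
  (H.inducedSub X).coe

/-- `H - x = H[V(H) \ {x}]`. -/
abbrev deleteVert (H : FinHypergraph.{u, v}) (x : H.V) : FinHypergraph.{u, v} :=
  H.induce {x}ᶜ

/-- The hypergraph `H(X)` obtained by shrinking `H` to `X`: every edge with at least two ends
in `X` is kept, and replaced by its intersection with `X`. -/
def shrink (H : FinHypergraph.{u, v}) (X : Set H.V) : FinHypergraph.{u, v} where
  V := X
  E := {e : H.E | 2 ≤ (H.inc e ∩ X).ncard}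
  finite_V := inferInstance
  finite_E := inferInstance
  inc e := Subtype.val ⁻¹' H.inc e
  two_le_inc e := by
    rw [ncard_preimage_val]
    exact e.2

/-- A hyperpath of length `q`: distinct vertices `vert 0, …, vert q` and distinct edges
`edge 0, …, edge (q - 1)` such that `edge i` is incident to `vert i` and `vert (i + 1)`. -/
structure Hyperpath (H : FinHypergraph.{u, v}) (q : ℕ) where
  vert : Fin (q + 1) → H.V
  edge : Fin q → H.E
  vert_injective : Function.Injective vert
  edge_injective : Function.Injective edge
  inc : ∀ i : Fin q, {vert i.castSucc, vert i.succ} ⊆ H.inc (edge i)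

def Connected (H : FinHypergraph.{u, v}) : Prop :=
  Nonempty H.V ∧ ∀ x y : H.V, ∃ (q : ℕ) (p : H.Hyperpath q),
    p.vert 0 = x ∧ p.vert (Fin.last q) = y

/-- `x` is separating: `H` is the union of two induced subhypergraphs, each with at least two
vertices, that have exactly the vertex `x` in common. -/
def IsSeparating (H : FinHypergraph.{u, v}) (x : H.V) : Prop :=
  ∃ X Y : Set H.V,
    X ∪ Y = Set.univ ∧
    (H.inducedSub X).edges ∪ (H.inducedSub Y).edges = Set.univ ∧
    X ∩ Y = {x} ∧ 2 ≤ X.ncard ∧ 2 ≤ Y.ncard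

/-- Blocks: maximal connected subhypergraphs without a separating vertex. -/
def IsBlock (H : FinHypergraph.{u, v}) (B : H.Sub) : Prop :=
  Maximal (fun A : H.Sub => A.coe.Connected ∧ ∀ x, ¬ A.coe.IsSeparating x) B

/-- A finite simple graph as a hypergraph. -/
def ofSimpleGraph {α : Type u} [Finite α] (G : SimpleGraph α) : FinHypergraph.{u, u} where
  V := α
  E := G.edgeSet
  finite_V := inferInstance
  finite_E := inferInstance
  inc e := {x | x ∈ (e : Sym2 α)}
  two_le_inc := by
    rintro ⟨e, he⟩
    induction e with
    | _ a b =>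
      have hab : a ≠ b := G.ne_of_adj he
      have : {x | x ∈ s(a, b)} = ({a, b} : Set α) := by
        ext x; simp
      rw [this, Set.ncard_pair hab]

/-- `tH`: every edge of `H` is replaced by `t` parallel edges. -/
def multiply (t : ℕ) (H : FinHypergraph.{u, v}) : FinHypergraph.{u, v} where
  V := H.V
  E := H.E × Fin t
  finite_V := inferInstance
  finite_E := inferInstance
  inc e := H.inc e.1
  two_le_inc e := H.two_le_inc e.1

/-- Bricks: `tK_n` with `t, n ≥ 1`, and `tC_n` with `t ≥ 1` and `n ≥ 3` odd, up to isomorphism. -/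
def IsBrick (H : FinHypergraph.{u, v}) : Prop :=
  (∃ t n : ℕ, 1 ≤ t ∧ 1 ≤ n ∧
    Nonempty (H.Iso (multiply t (ofSimpleGraph (⊤ : SimpleGraph (Fin n)))))) ∨
  (∃ t n : ℕ, 1 ≤ t ∧ 3 ≤ n ∧ Odd n ∧
    Nonempty (H.Iso (multiply t (ofSimpleGraph (SimpleGraph.cycleGraph n)))))

/-- A smooth hypergraph property: an isomorphism-closed class of hypergraphs that is hereditary
(closed under induced subhypergraphs) and non-trivial (it contains a non-empty hypergraph, but
not every hypergraph). -/
structure IsSmooth (P : FinHypergraph.{u, v} → Prop) : Prop where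
  iso_closed : ∀ H H' : FinHypergraph.{u, v}, Nonempty (H.Iso H') → P H → P H'
  hereditary : ∀ (H : FinHypergraph.{u, v}) (X : Set H.V), P H → P (H.induce X)
  exists_nonempty : ∃ H, P H ∧ Nonempty H.V
  exists_not : ∃ H, ¬ P H

/-- The class `F(P)` of hypergraphs that are not in `P` although all `H - x` are. -/
def MinForbidden (P : FinHypergraph.{u, v} → Prop) (H : FinHypergraph.{u, v}) : Prop :=
  ¬ P H ∧ ∀ x, P (H.deleteVert x)

/-- `d(P)`, the smallest minimum degree of a member of `F(P)` (`F(P)` is non-empty when `P` is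
smooth, so that the infimum in `ℕ` is then attained). -/
noncomputable def dMin (P : FinHypergraph.{u, v} → Prop) : ℕ :=
  sInf {k | ∃ H, MinForbidden P H ∧ H.minDegree = k}

/-- `(P, L)`-colorability, for a list-assignment `L` with values in the subsets of `C`. -/
def Colorable (P : FinHypergraph.{u, v} → Prop) (H : FinHypergraph.{u, v}) {C : Type w}
    (L : H.V → Set C) : Prop :=
  ∃ φ : H.V → C, (∀ x, φ x ∈ L x) ∧ ∀ c, P (H.induce (φ ⁻¹' {c}))

/-- `(P, L)`-criticality; the list-assignment is restricted to `V(H - x)`. -/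
def Critical (P : FinHypergraph.{u, v} → Prop) (H : FinHypergraph.{u, v}) {C : Type w}
    (L : H.V → Set C) : Prop :=
  (∀ x, Colorable P (H.deleteVert x) (fun y => L y.1)) ∧ ¬ Colorable P H L

/-- The set `V(H, P, L)` of low vertices, those with `d_H(x) = d(P) |L(x)|`. -/
def lowVerts (P : FinHypergraph.{u, v} → Prop) (H : FinHypergraph.{u, v}) {C : Type w}
    (L : H.V → Set C) : Set H.V :=
  {x | (H.degree x : ℕ∞) = (dMin P : ℕ∞) * (L x).encard}

/-- The low-vertex hypergraph `H(V(H, P, L))`. -/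
def lowHypergraph (P : FinHypergraph.{u, v} → Prop) (H : FinHypergraph.{u, v}) {C : Type w}
    (L : H.V → Set C) : FinHypergraph.{u, v} :=
  H.shrink (lowVerts P H L)

end FinHypergraph

/-! Write r for `dMin P`. Colour `H` minus a low vertex `x` of the block `B`. Each colour c in `L x`
is blocked: giving it to `x` creates a class outside `P`, hence a member of F(P) through `x`, so at
least r edges at `x` have all other ends coloured c. These edge sets are disjoint for different c
and the degree of `x` is r|L(x)|, so they partition the edges at `x` into sets of size exactly r
(`low_colorStar`). Therefore the colour of a neighbour may be moved into `x`, and the neighbour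
becomes the new uncoloured hole (`IsColoringOff.slide`). While the hole stays in `B`, colours
outside `B` are frozen; as every edge with two ends in `B` belongs to `B`, the number of edges of
`B` of a given colour at the hole depends on the hole only.

If every position is monochromatic on `B` minus the hole, all edges of `B` at the hole lie in one of
these sets, so all degrees are at most r. Then either `B` is in `P`, or a minimal vertex set
inducing a non-member already uses all edges at its vertices and, by connectedness, is all of `B`
(`minForbidden_of_degree_le`).

If some position shows two colours, `B` is a brick (`isBrick_of_isSliding`). Two colours are then
seen from every hole, which forces all edges to have two ends and leaves a question about weighted
simple graphs without cut vertices (`complete_or_odd_cycle`). The engine is `IsSliding.rotate`: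
driving the hole once around a cycle without chords at the hole must preserve the colour counts
there, which forces equal colours and equal weights. Two differently coloured neighbours of the hole
lie on an induced cycle through it, necessarily odd; length at least 5 makes it span the graph, and
length 3 makes the graph complete. -/

namespace SimpleGraph

/-! ### Geodesics and graphs without cut vertices -/

/-- A geodesic, indexed by an initial segment of the natural numbers. -/
theorem Reachable.exists_geodesic {V : Type*} {G : SimpleGraph V} {u v : V}
    (h : G.Reachable u v) :
    ∃ q : ℕ → V, q 0 = u ∧ q (G.dist u v) = v ∧
      (∀ i < G.dist u v, G.Adj (q i) (q (i + 1))) ∧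
      (∀ i ≤ G.dist u v, G.dist u (q i) = i ∧ G.Reachable u (q i) ∧
        G.dist (q i) v = G.dist u v - i) ∧
      ∀ i j, i ≤ j → j ≤ G.dist u v → G.dist (q i) (q j) = j - i := by
  obtain ⟨p, hp⟩ := h.exists_walk_length_eq_dist
  have h1 : ∀ i ≤ G.dist u v, G.dist u (p.getVert i) ≤ i := fun i hi =>
    (G.dist_le (p.take i)).trans (by simp)
  have h2 : ∀ i ≤ G.dist u v, G.dist (p.getVert i) v ≤ G.dist u v - i := fun i hi =>
    (G.dist_le (p.drop i)).trans (by simp [hp])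
  have r1 : ∀ i, G.Reachable u (p.getVert i) := fun i => ⟨p.take i⟩
  have r2 : ∀ i, G.Reachable (p.getVert i) v := fun i => ⟨p.drop i⟩
  have h3 : ∀ i j, i ≤ j → j ≤ G.dist u v →
      G.dist (p.getVert i) (p.getVert j) ≤ j - i := fun i j hij hj => by
    have e : (p.drop i).getVert (j - i) = p.getVert j := by
      rw [Walk.drop_getVert]; congr 1; omega
    have := (G.dist_le ((p.drop i).take (j - i))).trans (show _ ≤ j - i by simp)
    rwa [e] at this
  refine ⟨p.getVert, by simp, by simp [← hp], fun i hi => p.adj_getVert_succ (hp ▸ hi), ?_, ?_⟩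
  · intro i hi
    have t := (r1 i).dist_triangle_left v
    have := h1 i hi
    have := h2 i hi
    exact ⟨by omega, r1 i, by omega⟩
  · intro i j hij hj
    have a := h1 i (hij.trans hj)
    have b := h2 j hj
    have c := h3 i j hij hj
    have t1 := (r1 i).dist_triangle_left v
    have t2 := (r2 j).dist_triangle_right (p.getVert i)
    omega

/-- Connectedness together with connectedness after the removal of any single vertex. -/
def NoCut {V : Type*} (G : SimpleGraph V) : Prop :=
  G.Preconnected ∧ ∀ z a b, a ≠ z → b ≠ z → (G.deleteIncidenceSet z).Reachable a b

theorem Reachable.avoids {V : Type*} {G : SimpleGraph V} {x a b : V}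
    (h : (G.deleteIncidenceSet x).Reachable a b) (ha : a ≠ x) : b ≠ x := by
  obtain ⟨p⟩ := h
  induction p with
  | nil => exact ha
  | cons hadj _ ih => exact ih (G.deleteIncidenceSet_adj.1 hadj).2.2

/-! ### Sliding the hole along paths and ears -/

variable {V : Type*} {C : Type*} [DecidableEq V]

/-- `S x φ` says that `φ`, read off the hole `x`, is an admissible position; admissible positions
are closed under sliding the colour of a neighbour of the hole into the hole. -/
def IsSliding (G : SimpleGraph V) (S : V → (V → C) → Prop) : Prop :=
  ∀ x y φ, S x φ → G.Adj x y → S y (Function.update φ x (φ y))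

variable {G : SimpleGraph V} {S : V → (V → C) → Prop} {φ : V → C}

namespace IsSliding

/-- Moving the hole along a path shifts the colours of the path one step back towards its start and
touches nothing else. -/
theorem slide (hS : G.IsSliding S) (b : ℕ → V) (s : ℕ) (h0 : S (b 0) φ)
    (hadj : ∀ i < s, G.Adj (b i) (b (i + 1)))
    (hinj : ∀ i ≤ s, ∀ j ≤ s, b i = b j → i = j) :
    ∃ ψ, S (b s) ψ ∧ (∀ i < s, ψ (b i) = φ (b (i + 1))) ∧
      ∀ v, (∀ i ≤ s, v ≠ b i) → ψ v = φ v := by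
  induction s with
  | zero => exact ⟨φ, h0, by simp, by simp⟩
  | succ s ih =>
    obtain ⟨ψ, h1, h2, h3⟩ := ih (fun i hi => hadj i (by omega))
      (fun i hi j hj => hinj i (by omega) j (by omega))
    refine ⟨_, hS _ _ _ h1 (hadj s (by omega)), fun i hi => ?_, fun v hv => ?_⟩
    · rcases Nat.lt_succ_iff_lt_or_eq.1 hi with hi | rfl
      · rw [Function.update_of_ne, h2 i hi]
        intro h
        have := hinj _ (by omega) _ (by omega) h
        omega
      · rw [Function.update_self, h3]
        intro j hj h
        have := hinj _ (by omega) _ (by omega) h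
        omega
    · rw [Function.update_of_ne (hv s (by omega)), h3 v fun i hi => hv i (by omega)]

theorem exists_position (hS : G.IsSliding S) (hG : G.Preconnected) {x : V} (h : S x φ) (y : V) :
    ∃ ψ, S y ψ := by
  obtain ⟨p⟩ := hG x y
  induction p generalizing φ with
  | nil => exact ⟨φ, h⟩
  | cons hadj _ ih => exact ih (hS _ _ _ h hadj)

/-- The hole leaves `A` along an ear. -/
theorem ear (hS : G.IsSliding S) (hG : G.NoCut) {A : Set V} {x u w : V} (hx : x ∈ A) (hw : w ∈ A)
    (hwx : w ≠ x) (hu : u ∉ A) (hxu : G.Adj x u) :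
    ∃ y ∈ A, y ≠ x ∧ ∀ φ, S x φ → ∃ ψ, S y ψ ∧ ψ x = φ u ∧
      ∀ v ∈ A, v ≠ x → v ≠ y → ψ v = φ v := by
  set G' := G.deleteIncidenceSet x with hG'
  have hux : u ≠ x := fun h => hu (h ▸ hx)
  -- The ear ends at a vertex of `A` nearest to `u` in `G` minus `x`, so its interior avoids `A`.
  -- The choice precedes `φ`: the landing vertex is the same for all positions with hole `x`.
  obtain ⟨y, ⟨hyA, hyx⟩, hmin⟩ := exists_minimalFor_of_wellFoundedLT
    (fun y => y ∈ A ∧ y ≠ x) (fun y => G'.dist u y) ⟨w, hw, hwx⟩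
  obtain ⟨q, q0, ql, qadj, qd, qdist⟩ := (hG.2 x u y hux hyx).exists_geodesic
  set l := G'.dist u y with hl
  have hq : ∀ i ≤ l, q i ≠ x := fun i hi => (qd i hi).2.1.avoids hux
  have hint : ∀ i < l, q i ∉ A := fun i hi hA => by
    have h2 : G'.dist u (q i) = i := (qd i hi.le).1
    have h1 : l ≤ G'.dist u (q i) :=
      hmin ⟨hA, hq i hi.le⟩ (show G'.dist u (q i) ≤ l by omega)
    omega
  have hqinj : ∀ i ≤ l, ∀ j ≤ l, q i = q j → i = j := by
    intro i hi j hj h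
    have h1 := (qd i hi).1
    have h2 := (qd j hj).1
    rw [h, h2] at h1
    omega
  refine ⟨y, hyA, hyx, fun φ hφ => ?_⟩
  obtain ⟨ψ, h1, h2, h3⟩ := hS.slide (φ := φ) (fun i => if i = 0 then x else q (i - 1)) (l + 1)
    (by simpa using hφ)
    (by
      intro i hi
      rcases i with _ | i
      · simpa [q0] using hxu
      · simpa using (G.deleteIncidenceSet_adj.1 (qadj i (by omega))).1)
    (by
      intro i hi j hj h
      rcases i with _ | i <;> rcases j with _ | j
      · rfl
      · exact absurd h.symm (by simpa using hq j (by omega))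
      · exact absurd h (by simpa using hq i (by omega))
      · simpa using hqinj i (by omega) j (by omega) (by simpa using h))
  refine ⟨ψ, ?_, ?_, ?_⟩
  · simpa [← hl, ql] using h1
  · simpa [q0] using h2 0 (by omega)
  · intro v hv hvx hvy
    refine h3 v fun i hi => ?_
    rcases i with _ | i
    · simpa using hvx
    · rcases Nat.lt_or_ge i l with h | h
      · rintro rfl
        exact hint i h (by simpa using hv)
      · have : i = l := by omega
        simpa [this, ql] using hvy

end IsSliding

/-! ### Balanced systems and rotation of a cycle -/

variable [Fintype V] [DecidableEq C] {t : V → V → ℕ}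

/-- The total weight of the neighbours of the hole of a given colour is the same in all
positions with the same hole. -/
def IsBalanced (t : V → V → ℕ) (S : V → (V → C) → Prop) : Prop :=
  ∀ x φ ψ c, S x φ → S x ψ →
    (∑ y, if φ y = c then t x y else 0) = ∑ y, if ψ y = c then t x y else 0

namespace IsSliding

/-- Rotation of a cycle that has no chord at the hole. -/
theorem rotate (hS : G.IsSliding S) (hB : IsBalanced t S) (ht : ∀ x y, 0 < t x y ↔ G.Adj x y)
    (b : ℕ → V) {s : ℕ} (hs : 2 ≤ s) (h0 : S (b 0) φ)
    (hadj : ∀ i < s, G.Adj (b i) (b (i + 1))) (hclose : G.Adj (b s) (b 0))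
    (hinj : ∀ i ≤ s, ∀ j ≤ s, b i = b j → i = j)
    (hchord : ∀ i, 1 < i → i < s → ¬ G.Adj (b 0) (b i)) :
    φ (b 2) = φ (b s) ∧ (φ (b 1) ≠ φ (b s) → t (b 0) (b 1) = t (b 0) (b s)) := by
  obtain ⟨ψ, h1, h2, h3⟩ := hS.slide b s h0 hadj hinj
  have h4 := hS _ _ _ h1 hclose
  set χ := Function.update ψ (b s) (ψ (b 0)) with hχ
  have e1 : χ (b 1) = φ (b 2) := by
    rw [hχ, Function.update_of_ne, h2 1 (by omega)]
    intro h
    have := hinj _ (by omega) _ (by omega) h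
    omega
  have es : χ (b s) = φ (b 1) := by
    rw [hχ, Function.update_self, h2 0 (by omega)]
  have hne : b 1 ≠ b s := fun h => by
    have := hinj _ (by omega) _ (by omega) h
    omega
  -- Compare the counts at `b 0` before and after the turn. By chordlessness only `b 1` and `b s`
  -- see a change; they now carry the former colours of `b 2` and `b 1`. Taking c to be the colour
  -- of `b s` finishes.
  have key : ∀ c, ((if φ (b 1) = c then t (b 0) (b 1) else 0) +
      if φ (b s) = c then t (b 0) (b s) else 0) =
      (if φ (b 2) = c then t (b 0) (b 1) else 0) +
      if φ (b 1) = c then t (b 0) (b s) else 0 := by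
    intro c
    have hsum := hB _ _ _ c h0 h4
    rw [← Finset.sum_add_sum_compl {b 1, b s}, ← Finset.sum_add_sum_compl {b 1, b s},
      Finset.sum_pair hne, Finset.sum_pair hne, e1, es] at hsum
    refine Nat.add_right_cancel (hsum.trans (congrArg _ (Finset.sum_congr rfl ?_)))
    intro y hy
    simp only [Finset.mem_compl, Finset.mem_insert, Finset.mem_singleton, not_or] at hy
    by_cases hp : ∃ i ≤ s, y = b i
    · obtain ⟨i, hi, rfl⟩ := hp
      have : t (b 0) (b i) = 0 := by
        by_contra hpos
        have hA := (ht _ _).1 (Nat.pos_of_ne_zero hpos)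
        rcases i with _ | _ | i
        · exact G.irrefl hA
        · exact hy.1 rfl
        · refine hchord _ (by omega) (lt_of_le_of_ne hi ?_) hA
          rintro rfl
          exact hy.2 rfl
      simp [this]
    · have : ∀ i ≤ s, y ≠ b i := fun i hi h => hp ⟨i, hi, h⟩
      rw [hχ, Function.update_of_ne hy.2, h3 y this]
  have p1 : 0 < t (b 0) (b 1) := (ht _ _).2 (hadj 0 (by omega))
  have ps : 0 < t (b 0) (b s) := (ht _ _).2 hclose.symm
  have k := key (φ (b s))
  by_cases h : φ (b 1) = φ (b s)
  · refine ⟨?_, fun h' => absurd h h'⟩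
    by_contra h'
    simp [h, h'] at k
    omega
  · by_cases h' : φ (b 2) = φ (b s)
    · simp [h, h'] at k
      exact ⟨h', fun _ => k.symm⟩
    · simp [h, h'] at k
      omega

end IsSliding

end SimpleGraph

/-! ### Induced cycles indexed by `ZMod k` -/

theorem ZMod.natCast_injOn_lt {k i j : ℕ} (hi : i < k) (hj : j < k)
    (h : (i : ZMod k) = j) : i = j := by
  have := (ZMod.natCast_eq_natCast_iff' i j k).1 h
  rwa [Nat.mod_eq_of_lt hi, Nat.mod_eq_of_lt hj] at this

theorem ZMod.natCast_pred_self {k : ℕ} (hk : 1 ≤ k) : ((k - 1 : ℕ) : ZMod k) = -1 := by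
  rw [Nat.cast_sub hk]; simp

namespace SimpleGraph

variable {V : Type*} {C : Type*}

/-- `p` parametrizes an induced cycle of length `k` of `G`. -/
structure IsInducedCycle (G : SimpleGraph V) {k : ℕ} (p : ZMod k → V) : Prop where
  injective : Function.Injective p
  adj_iff : ∀ i j, G.Adj (p i) (p j) ↔ j = i + 1 ∨ i = j + 1

variable {G : SimpleGraph V} {S : V → (V → C) → Prop} {φ : V → C} {k : ℕ} {p : ZMod k → V}

namespace IsInducedCycle

theorem translate (hp : G.IsInducedCycle p) (j : ZMod k) : G.IsInducedCycle fun i => p (j + i) where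
  injective a b h := add_left_cancel (hp.injective h)
  adj_iff a b := by rw [hp.adj_iff, add_assoc, add_assoc, add_right_inj, add_right_inj]

theorem reflect (hp : G.IsInducedCycle p) : G.IsInducedCycle fun i => p (-i) where
  injective a b h := neg_injective (hp.injective h)
  adj_iff a b := by
    rw [hp.adj_iff, or_comm]
    constructor <;> rintro (h | h)
    · left; linear_combination h
    · right; linear_combination h
    · left; linear_combination h
    · right; linear_combination h

theorem adj_succ (hp : G.IsInducedCycle p) (i : ZMod k) : G.Adj (p i) (p (i + 1)) :=
  (hp.adj_iff _ _).2 (Or.inl rfl)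

theorem natCast_inj (hp : G.IsInducedCycle p) {i j : ℕ} (hi : i < k) (hj : j < k)
    (h : p i = p j) : i = j :=
  ZMod.natCast_injOn_lt hi hj (hp.injective h)

end IsInducedCycle

variable [DecidableEq V] [Fintype V] [DecidableEq C] {t : V → V → ℕ}

namespace IsInducedCycle

theorem rotate (hp : G.IsInducedCycle p) (hk : 3 ≤ k) (hS : G.IsSliding S) (hB : IsBalanced t S)
    (ht : ∀ x y, 0 < t x y ↔ G.Adj x y) (h0 : S (p 0) φ) :
    φ (p 2) = φ (p (-1)) ∧ (φ (p 1) ≠ φ (p (-1)) → t (p 0) (p 1) = t (p 0) (p (-1))) := by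
  have e := ZMod.natCast_pred_self (k := k) (by omega)
  have h := hS.rotate (φ := φ) hB ht (fun i : ℕ => p i) (s := k - 1) (by omega) (by simpa using h0)
    (fun i _ => by simpa using hp.adj_succ i)
    (by simpa [e] using hp.adj_succ (-1))
    (fun i hi j hj => hp.natCast_inj (by omega) (by omega))
    (by
      intro i hi hi' hA
      rcases (hp.adj_iff _ _).1 hA with h | h
      · have : ((i : ℕ) : ZMod k) = (1 : ℕ) := by rw [h]; simp
        have := ZMod.natCast_injOn_lt (by omega) (by omega) this
        omega
      · have : ((i + 1 : ℕ) : ZMod k) = (0 : ℕ) := by push_cast; rw [← h]; simp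
        have := ZMod.natCast_injOn_lt (by omega) (by omega) this
        omega)
  simpa [e] using h

/-- The colours along an induced cycle alternate. -/
theorem alternate (hp : G.IsInducedCycle p) (hk : 3 ≤ k) (hS : G.IsSliding S)
    (hB : IsBalanced t S) (ht : ∀ x y, 0 < t x y ↔ G.Adj x y) (h0 : S (p 0) φ) {n : ℕ}
    (hn : 1 ≤ n) (hnk : n + 3 ≤ k) : φ (p ((n + 2 : ℕ) : ZMod k)) = φ (p (n : ZMod k)) := by
  -- Move the hole to `p n` and rotate there: `p (n - 1)` now carries the old colour of `p n`, while
  -- `p (n + 2)` has not been reached because n + 2 < k.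
  obtain ⟨ψ, h1, h2, h3⟩ := hS.slide (φ := φ) (fun i : ℕ => p i) n (by simpa using h0)
    (fun i _ => by simpa using hp.adj_succ i)
    (fun i hi j hj => hp.natCast_inj (by omega) (by omega))
  have h4 := ((hp.translate n).rotate hk hS hB ht (φ := ψ) (by simpa using h1)).1
  have h5 := h2 (n - 1) (by omega)
  rw [Nat.sub_add_cancel hn, Nat.cast_sub hn] at h5
  rw [← h3 (p ((n + 2 : ℕ) : ZMod k)), ← h5]
  · simpa [sub_eq_add_neg] using h4
  · intro i hi h
    have := hp.natCast_inj (by omega) (by omega) h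
    omega

/-- For even `k` the alternation would run through 1, 3, ..., k - 1 and give both neighbours of the
hole the same colour. -/
theorem odd_length (hp : G.IsInducedCycle p) (hk : 3 ≤ k) (hS : G.IsSliding S)
    (hB : IsBalanced t S) (ht : ∀ x y, 0 < t x y ↔ G.Adj x y) (h0 : S (p 0) φ)
    (hne : φ (p 1) ≠ φ (p (-1))) : Odd k := by
  by_contra hodd
  obtain ⟨m, hm⟩ := Nat.not_odd_iff_even.1 hodd
  have : ∀ n, 2 * n + 2 ≤ k → φ (p ((2 * n + 1 : ℕ) : ZMod k)) = φ (p 1) := by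
    intro n
    induction n with
    | zero => simp
    | succ n ih =>
      intro hn
      rw [← ih (by omega), ← hp.alternate hk hS hB ht h0 (n := 2 * n + 1) (by omega) (by omega)]
      rfl
  have h := this (m - 1) (by omega)
  rw [show 2 * (m - 1) + 1 = k - 1 by omega, ZMod.natCast_pred_self (by omega)] at h
  exact hne h.symm

/-- A full turn of the hole around an induced cycle. -/
theorem turn (hp : G.IsInducedCycle p) (hk : 3 ≤ k) (hS : G.IsSliding S)
    (hB : IsBalanced t S) (ht : ∀ x y, 0 < t x y ↔ G.Adj x y) (h0 : S (p 0) φ) :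
    ∃ ψ, S (p 0) ψ ∧ ψ (p 1) = φ (p (-1)) ∧ ψ (p (-1)) = φ (p 1) ∧
      ∀ v, v ∉ Set.range p → ψ v = φ v := by
  have e := ZMod.natCast_pred_self (k := k) (by omega)
  obtain ⟨ψ, h1, h2, h3⟩ := hS.slide (φ := φ) (fun i : ℕ => p i) (k - 1) (by simpa using h0)
    (fun i _ => by simpa using hp.adj_succ i)
    (fun i hi j hj => hp.natCast_inj (by omega) (by omega))
  simp only [e] at h1
  refine ⟨_, hS (p (-1)) (p 0) ψ h1 (by simpa using hp.adj_succ (-1)), ?_, ?_, ?_⟩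
  · have := h2 1 (by omega)
    rw [Function.update_of_ne]
    · rw [← (hp.rotate hk hS hB ht h0).1]
      simpa [one_add_one_eq_two] using this
    · intro h
      have := ZMod.natCast_injOn_lt (k := k) (i := 1) (j := k - 1) (by omega) (by omega)
        (by rw [e]; simpa using hp.injective h)
      omega
  · have := h2 0 (by omega)
    rw [Function.update_self]
    simpa using this
  · intro v hv
    rw [Function.update_of_ne (fun h => hv ⟨_, h.symm⟩)]
    exact h3 v fun i _ h => hv ⟨_, h.symm⟩

/-- Used when an ear from `p 0` lands on `p 1`. Rotation at `p 1` ties the colour of `p 0` to that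
of `p 3`, which is unchanged and, by alternation in `φ`, equals the original colour of `p 1`. -/
theorem eq_of_slide_one (hp : G.IsInducedCycle p) (hk : 5 ≤ k)
    (hS : G.IsSliding S) (hB : IsBalanced t S) (ht : ∀ x y, 0 < t x y ↔ G.Adj x y)
    (h0 : S (p 0) φ) {ψ : V → C} (h1 : S (p 1) ψ) (h : ∀ i, i ≠ 0 → i ≠ 1 → ψ (p i) = φ (p i)) :
    ψ (p 0) = φ (p 1) := by
  have h2 := ((hp.translate 1).rotate (by omega) hS hB ht (φ := ψ) (by simpa using h1)).1
  have h3 := hp.alternate (by omega) hS hB ht h0 le_rfl (n := 1) (by omega)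
  have e : (1 : ZMod k) + 2 = ((1 + 2 : ℕ) : ZMod k) := by push_cast; ring
  have n0 : ((1 + 2 : ℕ) : ZMod k) ≠ 0 := fun h => by
    have := ZMod.natCast_injOn_lt (k := k) (i := 1 + 2) (j := 0) (by omega) (by omega)
      (by simpa using h)
    omega
  have n1 : ((1 + 2 : ℕ) : ZMod k) ≠ 1 := fun h => by
    have := ZMod.natCast_injOn_lt (k := k) (i := 1 + 2) (j := 1) (by omega) (by omega)
      (by simpa using h)
    omega
  simp only [e, add_neg_cancel] at h2
  rw [← h2, h _ n0 n1, h3, Nat.cast_one]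

/-- A long induced cycle seen in two colours from the hole has no outer neighbours at the hole. -/
theorem neighbor_mem_range (hp : G.IsInducedCycle p) (hk : 5 ≤ k) (hG : G.NoCut)
    (hS : G.IsSliding S) (hB : IsBalanced t S) (ht : ∀ x y, 0 < t x y ↔ G.Adj x y)
    (h0 : S (p 0) φ) (hne : φ (p 1) ≠ φ (p (-1))) {u : V} (hu : G.Adj (p 0) u) :
    u ∈ Set.range p := by
  by_contra hur
  have hk3 : 3 ≤ k := by omega
  have : NeZero k := ⟨by omega⟩
  obtain ⟨_, ⟨j, rfl⟩, hj0, hear⟩ := hS.ear hG (A := Set.range p) ⟨0, rfl⟩ ⟨1, rfl⟩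
    (by simpa using (hp.adj_succ 0).ne') hur hu
  have hear' : ∀ φ, S (p 0) φ → ∃ ψ, S (p j) ψ ∧ ψ (p 0) = φ u ∧
      ∀ i, i ≠ 0 → i ≠ j → ψ (p i) = φ (p i) := fun φ hφ => by
    obtain ⟨ψ, a, b, c⟩ := hear φ hφ
    exact ⟨ψ, a, b, fun i hi hij =>
      c _ ⟨i, rfl⟩ (hp.injective.ne hi) (hp.injective.ne hij)⟩
  -- An ear through `u` must land next to `p 0`, and `u` must have had the colour of the landing
  -- vertex.
  have key : ∀ φ, S (p 0) φ → φ (p 1) ≠ φ (p (-1)) →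
      (j = 1 ∧ φ u = φ (p 1)) ∨ (j = -1 ∧ φ u = φ (p (-1))) := by
    intro φ hφ hne
    obtain ⟨ψ, h1, h2, h3⟩ := hear' φ hφ
    by_cases hj1 : j = 1
    · subst hj1
      exact Or.inl ⟨rfl, h2 ▸ hp.eq_of_slide_one hk hS hB ht hφ h1 h3⟩
    by_cases hj2 : j = -1
    · subst hj2
      refine Or.inr ⟨rfl, h2 ▸ ?_⟩
      simpa using hp.reflect.eq_of_slide_one hk hS hB ht (φ := φ) (ψ := ψ) (by simpa using hφ) h1
        (fun i hi hi' => h3 _ (by simpa using hi) (by simpa using hi'))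
    exfalso
    have hj0' : j ≠ 0 := fun h => hj0 (h ▸ rfl)
    -- With the hole at a `p j` not adjacent to `p 0`, alternation at offset n = -j - 1 equates the
    -- colours of `p (-1)` and `p 1`, which the ear left untouched and distinct.
    have hcast : (((-j).val : ℕ) : ZMod k) = -j := ZMod.natCast_zmod_val _
    have hlt := ZMod.val_lt (-j)
    obtain ⟨n, hn⟩ : ∃ n, (-j).val = n + 1 := by
      refine Nat.exists_eq_succ_of_ne_zero fun h => hj0' ?_
      rwa [ZMod.val_eq_zero, neg_eq_zero] at h
    have hn' : (n : ZMod k) = -j - 1 := by rw [← hcast, hn]; push_cast; ring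
    have hn1 : 1 ≤ n := by
      rcases n with _ | n
      · exfalso; apply hj2; push_cast at hn'; linear_combination hn'
      · omega
    have hn2 : n + 3 ≤ k := by
      by_contra hlt'
      apply hj1
      have : (n : ZMod k) = -1 - 1 := by
        rw [show n = k - 1 - 1 by omega, Nat.cast_sub (by omega),
          ZMod.natCast_pred_self (by omega)]
        simp
      linear_combination hn' - this
    have h4 := (hp.translate j).alternate hk3 hS hB ht (φ := ψ) (by simpa using h1) hn1 hn2
    have e1 : j + ((n + 2 : ℕ) : ZMod k) = 1 := by push_cast; rw [hn']; ring
    have e2 : j + (n : ZMod k) = -1 := by rw [hn']; ring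
    have n1 : (1 : ZMod k) ≠ 0 := fun h => by
      have := ZMod.natCast_injOn_lt (k := k) (i := 1) (j := 0) (by omega) (by omega)
        (by simpa using h)
      omega
    simp only [e1, e2] at h4
    rw [h3 _ n1 (Ne.symm hj1), h3 _ (by simpa using n1) (Ne.symm hj2)] at h4
    exact hne h4
  -- A full turn exchanges the colours of `p 1` and `p (-1)` but preserves that of `u`, while the
  -- landing index `j` stays the same; so the conclusions of `key` before and after conflict.
  obtain ⟨ψ, t1, t2, t3, t4⟩ := hp.turn hk3 hS hB ht h0
  have a := key φ h0 hne
  have b := key ψ t1 (by rw [t2, t3]; exact hne.symm)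
  rw [t2, t3, t4 u hur] at b
  rcases a with ⟨a1, a2⟩ | ⟨a1, a2⟩ <;> rcases b with ⟨b1, b2⟩ | ⟨b1, b2⟩
  · exact hne (a2.symm.trans b2)
  · exact hne (congrArg (fun i => φ (p i)) (a1.symm.trans b1))
  · exact hne (congrArg (fun i => φ (p i)) (b1.symm.trans a1))
  · exact hne (b2.symm.trans a2)

/-- A long induced cycle seen in two colours is everything, is odd, and has constant weight. -/
theorem spanning (hp : G.IsInducedCycle p) (hk : 5 ≤ k) (hG : G.NoCut)
    (hS : G.IsSliding S) (hB : IsBalanced t S) (ht : ∀ x y, 0 < t x y ↔ G.Adj x y)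
    (hsymm : ∀ x y, t x y = t y x) (h0 : S (p 0) φ) (hne : φ (p 1) ≠ φ (p (-1))) :
    Odd k ∧ Function.Surjective p ∧ ∀ x y, G.Adj x y → t x y = t (p 0) (p 1) := by
  have hk3 : 3 ≤ k := by omega
  have : NeZero k := ⟨by omega⟩
  -- Two colours remain visible as the hole advances: the vertex behind receives the colour of `p (j
  -- + 1)`, and the one ahead has, by rotation, the colour of `p (j - 1)`.
  have good : ∀ j : ZMod k, ∃ φ, S (p j) φ ∧ φ (p (j + 1)) ≠ φ (p (j + -1)) := by
    have : ∀ n : ℕ, ∃ φ, S (p n) φ ∧ φ (p (n + 1)) ≠ φ (p (n + -1)) := by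
      intro n
      induction n with
      | zero => exact ⟨φ, by simpa using h0, by simpa using hne⟩
      | succ n ih =>
        obtain ⟨φ, h1, h2⟩ := ih
        have hp' := hp.translate n
        have h3 := (hp'.rotate hk3 hS hB ht (φ := φ) (by simpa using h1)).1
        refine ⟨_, hS (p n) (p ((n + 1 : ℕ) : ZMod k)) φ h1 (by simpa using hp.adj_succ n), ?_⟩
        have e1 : ((n + 1 : ℕ) : ZMod k) + 1 = n + 2 := by push_cast; ring
        have e2 : ((n + 1 : ℕ) : ZMod k) + -1 = n := by push_cast; ring
        rw [e1, e2, Function.update_self, Function.update_of_ne, h3]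
        · simpa using h2.symm
        · intro h
          have h' : (n : ZMod k) + 2 = n := hp.injective h
          have := ZMod.natCast_injOn_lt (k := k) (i := 2) (j := 0) (by omega) (by omega)
            (by simpa using h')
          omega
    intro j
    simpa using this j.val
  have hsurj : Function.Surjective p := by
    intro v
    obtain ⟨w⟩ := hG.1 (p 0) v
    have : ∀ a b (w : G.Walk a b), a ∈ Set.range p → b ∈ Set.range p := by
      intro a b w
      induction w with
      | nil => exact id
      | cons hadj _ ih =>
        rintro ⟨j, rfl⟩
        obtain ⟨φ, h1, h2⟩ := good j
        obtain ⟨i, hi⟩ := (hp.translate j).neighbor_mem_range hk hG hS hB ht (φ := φ)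
          (by simpa using h1) h2 (by simpa using hadj)
        exact ih ⟨_, hi⟩
    exact this _ _ w ⟨0, rfl⟩
  have hconst : ∀ j : ZMod k, t (p j) (p (j + 1)) = t (p 0) (p 1) := by
    have : ∀ n : ℕ, t (p n) (p (n + 1)) = t (p 0) (p 1) := by
      intro n
      induction n with
      | zero => simp
      | succ n ih =>
        obtain ⟨φ, h1, h2⟩ := good ((n + 1 : ℕ) : ZMod k)
        have h3 := ((hp.translate ((n + 1 : ℕ) : ZMod k)).rotate hk3 hS hB ht (φ := φ)
          (by simpa using h1)).2 h2
        have e2 : ((n + 1 : ℕ) : ZMod k) + -1 = n := by push_cast; ring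
        simp only [e2, add_zero] at h3
        rw [h3, hsymm, ← ih, Nat.cast_succ]
    intro j
    simpa using this j.val
  refine ⟨hp.odd_length hk3 hS hB ht h0 hne, hsurj, fun x y hxy => ?_⟩
  obtain ⟨i, rfl⟩ := hsurj x
  obtain ⟨j, rfl⟩ := hsurj y
  rcases (hp.adj_iff _ _).1 hxy with rfl | rfl
  · exact hconst i
  · rw [hsymm, hconst]

end IsInducedCycle

end SimpleGraph

/-! ### Finding an induced cycle through the hole -/

theorem ZMod.eq_add_one_iff_val {n : ℕ} (i j : ZMod (n + 2)) :
    j = i + 1 ↔ j.val = i.val + 1 ∨ (i.val = n + 1 ∧ j.val = 0) := by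
  have hi := ZMod.val_lt i
  have hj := ZMod.val_lt j
  have : (i + 1).val = (i.val + 1) % (n + 2) := by
    rw [ZMod.val_add, ZMod.val_one'' (by omega)]
  rw [← (ZMod.val_injective (n + 2)).eq_iff, this]
  rcases Nat.lt_or_ge (i.val + 1) (n + 2) with h | h
  · rw [Nat.mod_eq_of_lt h]; omega
  · rw [show i.val + 1 = n + 2 by omega, Nat.mod_self]; omega

namespace SimpleGraph

variable {V : Type*} {C : Type*} {G : SimpleGraph V} {S : V → (V → C) → Prop} {φ : V → C}

theorem Preconnected.mem_of_closed (hG : G.Preconnected) {A : Set V} {a : V} (ha : a ∈ A)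
    (h : ∀ x ∈ A, ∀ y, G.Adj x y → y ∈ A) (v : V) : v ∈ A := by
  obtain ⟨w⟩ := hG a v
  induction w with
  | nil => exact ha
  | cons hadj _ ih => exact ih (h _ ha _ hadj)

/-- Two neighbours of `x` of different colours produce an induced cycle through `x` with
differently coloured neighbours of `x`. -/
theorem NoCut.exists_isInducedCycle (hG : G.NoCut) {x y z : V} (hy : G.Adj x y)
    (hz : G.Adj x z) (hne : φ y ≠ φ z) :
    ∃ k, 3 ≤ k ∧ ∃ p : ZMod k → V, G.IsInducedCycle p ∧ p 0 = x ∧ φ (p 1) ≠ φ (p (-1)) := by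
  set G' := G.deleteIncidenceSet x with hG'
  obtain ⟨⟨a, b⟩, ⟨ha, hb, hab⟩, hmin⟩ := exists_minimalFor_of_wellFoundedLT
    (fun s : V × V => G.Adj x s.1 ∧ G.Adj x s.2 ∧ φ s.1 ≠ φ s.2) (fun s => G'.dist s.1 s.2)
    ⟨(y, z), hy, hz, hne⟩
  have hmin' : ∀ c d, G.Adj x c → G.Adj x d → φ c ≠ φ d → G'.dist a b ≤ G'.dist c d := by
    intro c d hc hd hcd
    by_contra hlt
    exact hlt (hmin (j := (c, d)) ⟨hc, hd, hcd⟩ (not_le.1 hlt).le)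
  dsimp only at ha hb hab
  have hreach := hG.2 x a b ha.ne' hb.ne'
  obtain ⟨q, q0, ql, qadj, qd, qdist⟩ := hreach.exists_geodesic
  have hl1 : 0 < G'.dist a b := hreach.pos_dist_of_ne fun h => hab (h ▸ rfl)
  set l := G'.dist a b with hl
  have hqx : ∀ i ≤ l, q i ≠ x := fun i hi => (qd i hi).2.1.avoids ha.ne'
  have hqadj : ∀ i ≤ l, ∀ j ≤ l, G.Adj (q i) (q j) → j = i + 1 ∨ i = j + 1 := by
    intro i hi j hj h
    have h' : G'.Adj (q i) (q j) := G.deleteIncidenceSet_adj.2 ⟨h, hqx i hi, hqx j hj⟩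
    rcases le_total i j with hij | hij
    · have := qdist i j hij hj
      rw [dist_eq_one_iff_adj.2 h'] at this
      omega
    · have := qdist j i hij hi
      rw [dist_eq_one_iff_adj.2 h'.symm] at this
      omega
  -- An inner vertex of the geodesic adjacent to `x` differs in colour from `a` or from `b`, and
  -- would form a closer pair with it.
  have hqx_adj : ∀ i ≤ l, G.Adj x (q i) → i = 0 ∨ i = l := by
    intro i hi h
    by_cases hc : φ a = φ (q i)
    · have h1 : l ≤ G'.dist (q i) b := hmin' _ _ h hb (hc ▸ hab)
      have h2 : G'.dist (q i) b = l - i := (qd i hi).2.2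
      omega
    · have h1 : l ≤ G'.dist a (q i) := hmin' _ _ ha h hc
      have h2 : G'.dist a (q i) = i := (qd i hi).1
      omega
  have hqinj : ∀ i ≤ l, ∀ j ≤ l, q i = q j → i = j := by
    intro i hi j hj h
    have h1 : G'.dist a (q i) = i := (qd i hi).1
    have h2 : G'.dist a (q j) = j := (qd j hj).1
    rw [h, h2] at h1
    omega
  obtain ⟨P, hP⟩ : ∃ P : ℕ → V, P = fun i => if i = 0 then x else q (i - 1) := ⟨_, rfl⟩
  have P0 : P 0 = x := by simp [hP]
  have PS : ∀ i, P (i + 1) = q i := by simp [hP]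
  have Padj : ∀ i < l + 2, ∀ j < l + 2, G.Adj (P i) (P j) ↔
      (j = i + 1 ∨ i = l + 1 ∧ j = 0) ∨ i = j + 1 ∨ j = l + 1 ∧ i = 0 := by
    intro i hi j hj
    have hx0 : ∀ i < l + 1, G.Adj x (q i) ↔ i = 0 ∨ i = l := fun i hi =>
      ⟨hqx_adj i (by omega), by rintro (rfl | rfl) <;> simpa [q0, ql]⟩
    rcases i with _ | i <;> rcases j with _ | j
    · simp [P0]
    · rw [P0, PS, hx0 _ (by omega)]; omega
    · rw [P0, PS, G.adj_comm, hx0 _ (by omega)]; omega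
    · rw [PS, PS]
      constructor
      · intro h
        have := hqadj i (by omega) j (by omega) h
        omega
      · intro h
        have : j = i + 1 ∨ i = j + 1 := by omega
        rcases this with rfl | rfl
        · exact (G.deleteIncidenceSet_adj.1 (qadj i (by omega))).1
        · exact (G.deleteIncidenceSet_adj.1 (qadj j (by omega))).1.symm
  refine ⟨l + 2, by omega, fun i => P i.val, ⟨?_, ?_⟩, by simpa using P0, ?_⟩
  · intro i j h
    have hi := ZMod.val_lt i
    have hj := ZMod.val_lt j
    apply ZMod.val_injective
    replace h : P i.val = P j.val := h
    revert h hi hj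
    generalize i.val = i
    generalize j.val = j
    intro hi hj h
    rcases i with _ | i <;> rcases j with _ | j
    · rfl
    · exact absurd (by simpa [P0, PS] using h.symm) (hqx j (by omega))
    · exact absurd (by simpa [P0, PS] using h) (hqx i (by omega))
    · rw [hqinj i (by omega) j (by omega) (by simpa [PS] using h)]
  · intro i j
    rw [Padj _ (ZMod.val_lt i) _ (ZMod.val_lt j), ZMod.eq_add_one_iff_val,
      ZMod.eq_add_one_iff_val]
  · have e1 : (1 : ZMod (l + 2)).val = 0 + 1 := ZMod.val_one'' (by omega)
    have e2 : (-1 : ZMod (l + 2)).val = l + 1 := ZMod.val_neg_one (l + 1)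
    simp only [e1, e2, PS, q0, ql]
    exact hab

/-! ### Triangles, cliques and the classification of graphs -/

variable [DecidableEq V]

namespace IsSliding

/-- Sliding around a triangle swaps two colours. -/
theorem swap (hS : G.IsSliding S) {x v w : V} (hxv : G.Adj x v) (hvw : G.Adj v w)
    (hwx : G.Adj w x) (h : S x φ) :
    ∃ ψ, S x ψ ∧ ψ v = φ w ∧ ψ w = φ v ∧ ∀ u, u ≠ x → u ≠ v → u ≠ w → ψ u = φ u := by
  refine ⟨_, hS _ _ _ (hS _ _ _ (hS _ _ _ h hxv) hvw) hwx, ?_, ?_, ?_⟩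
  · rw [Function.update_of_ne hvw.ne, Function.update_self, Function.update_of_ne hwx.ne]
  · rw [Function.update_self, Function.update_of_ne hxv.ne, Function.update_self]
  · intro u h1 h2 h3
    rw [Function.update_of_ne h3, Function.update_of_ne h2, Function.update_of_ne h1]

/-- One slide brings the hole to `x'` without changing the colours occurring on the rest of the
clique. If `v` and `w` then agree, exchanging `v` with a clique vertex of another colour through a
triangle separates them. -/
theorem exists_ne_of_isClique (hS : G.IsSliding S) {K : Set V} (hK : G.IsClique K) {x y z : V}
    (hx : x ∈ K) (hy : y ∈ K) (hz : z ∈ K) (hyx : y ≠ x) (hzx : z ≠ x) (h : S x φ)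
    (hne : φ y ≠ φ z) {x' v w : V} (hx' : x' ∈ K) (hv : v ∈ K) (hvx : v ≠ x')
    (hwx : w ≠ x') (hvw : v ≠ w) : ∃ ψ, S x' ψ ∧ ψ v ≠ ψ w := by
  obtain ⟨ψ, hψ, a, ha, hax, b, hb, hbx, hab⟩ : ∃ ψ, S x' ψ ∧ ∃ a ∈ K, a ≠ x' ∧ ∃ b ∈ K, b ≠ x' ∧
      ψ a ≠ ψ b := by
    by_cases hxx : x = x'
    · subst hxx
      exact ⟨φ, h, y, hy, hyx, z, hz, hzx, hne⟩
    refine ⟨_, hS _ _ _ h (hK hx hx' hxx), ?_⟩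
    by_cases h1 : y = x'
    · subst h1
      exact ⟨x, hx, hxx, z, hz, fun h => hne (h ▸ rfl), by
        rwa [Function.update_self, Function.update_of_ne hzx]⟩
    by_cases h2 : z = x'
    · subst h2
      exact ⟨x, hx, hxx, y, hy, h1, by
        rw [Function.update_self, Function.update_of_ne hyx]; exact hne.symm⟩
    · exact ⟨y, hy, h1, z, hz, h2, by
        rwa [Function.update_of_ne hyx, Function.update_of_ne hzx]⟩
  by_cases hψvw : ψ v = ψ w
  · obtain ⟨c, hc, hcx, hcv⟩ : ∃ c ∈ K, c ≠ x' ∧ ψ c ≠ ψ v := by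
      by_cases h : ψ a = ψ v
      · exact ⟨b, hb, hbx, fun h' => hab (h.trans h'.symm)⟩
      · exact ⟨a, ha, hax, h⟩
    have hcv' : c ≠ v := fun h => hcv (h ▸ rfl)
    have hcw' : c ≠ w := fun h => hcv (h ▸ hψvw.symm)
    obtain ⟨χ, h1, h2, h3, h4⟩ := hS.swap (hK hx' hv hvx.symm) (hK hv hc hcv'.symm)
      (hK hc hx' hcx) hψ
    exact ⟨χ, h1, by rw [h2, h4 w hwx hvw.symm hcw'.symm, ← hψvw]; exact hcv⟩
  · exact ⟨ψ, hψ, hψvw⟩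

variable [Fintype V] [DecidableEq C] {t : V → V → ℕ}

theorem rotate_three (hS : G.IsSliding S) (hB : IsBalanced t S)
    (ht : ∀ x y, 0 < t x y ↔ G.Adj x y) {x v w : V} (hxv : G.Adj x v) (hvw : G.Adj v w)
    (hwx : G.Adj w x) (h : S x φ) (hne : φ v ≠ φ w) : t x v = t x w := by
  refine (hS.rotate (φ := φ) hB ht
    (fun i => if i = 0 then x else if i = 1 then v else w) (s := 2) le_rfl (by simpa using h)
    ?_ (by simpa using hwx) ?_ (by intros; omega)).2 (by simpa using hne)
  · intro i hi
    interval_cases i <;> simpa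
  · have := hxv.ne
    have := hvw.ne
    have := hwx.ne
    intro i hi j hj
    interval_cases i <;> interval_cases j <;> simp_all [eq_comm]

/-- The chord `v w` is allowed: rotation only forbids chords at the hole `x`. -/
theorem rotate_four (hS : G.IsSliding S) (hB : IsBalanced t S)
    (ht : ∀ x y, 0 < t x y ↔ G.Adj x y) {x v u w : V} (hxv : G.Adj x v) (hvu : G.Adj v u)
    (huw : G.Adj u w) (hwx : G.Adj w x) (hvw : v ≠ w) (hxu : ¬ G.Adj x u) (hxu' : x ≠ u)
    (h : S x φ) : φ u = φ w := by
  refine (hS.rotate (φ := φ) hB ht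
    (fun i => if i = 0 then x else if i = 1 then v else if i = 2 then u else w) (s := 3)
    (by omega) (by simpa using h) ?_ (by simpa using hwx) ?_ ?_).1
  · intro i hi
    interval_cases i <;> simpa
  · have := hxv.ne
    have := hvu.ne
    have := huw.ne
    have := hwx.ne
    intro i hi j hj
    interval_cases i <;> interval_cases j <;> simp_all [eq_comm]
  · intro i h1 h2
    interval_cases i
    simpa

/-- If a triangle is seen in two colours, then the graph is complete with constant weight. -/
theorem complete (hS : G.IsSliding S) (hG : G.NoCut) (hB : IsBalanced t S)
    (ht : ∀ x y, 0 < t x y ↔ G.Adj x y) (hsymm : ∀ x y, t x y = t y x) {x y z : V}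
    (hxy : G.Adj x y) (hyz : G.Adj y z) (hzx : G.Adj z x) (h : S x φ) (hne : φ y ≠ φ z) :
    (∀ a b, a ≠ b → G.Adj a b) ∧ ∀ a b, a ≠ b → t a b = t x y := by
  -- Extend the triangle to a maximal clique `K`; the aim is that no edge leaves `K`.
  obtain ⟨K, hxyz, hKmax⟩ := (Set.toFinite {K : Set V | G.IsClique K}).exists_le_maximal
    (a := {x, y, z}) (by
      simp [IsClique, Set.pairwise_insert, hxy, hyz, hzx, hxy.symm, hyz.symm, hzx.symm])
  have hK : G.IsClique K := hKmax.prop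
  have hx : x ∈ K := hxyz (by simp)
  have hy : y ∈ K := hxyz (by simp)
  have hz : z ∈ K := hxyz (by simp)
  have hcol : ∀ {x' v w}, x' ∈ K → v ∈ K → v ≠ x' → w ≠ x' → v ≠ w →
      ∃ ψ, S x' ψ ∧ ψ v ≠ ψ w := fun h1 h2 h3 h4 h5 =>
    hS.exists_ne_of_isClique hK hx hy hz hxy.ne' hzx.ne h hne h1 h2 h3 h4 h5
  have hthird : ∀ v w, ∃ c ∈ K, c ≠ v ∧ c ≠ w := by
    intro v w
    have := hxy.ne
    have := hyz.ne
    have := hzx.ne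
    by_cases h1 : x ≠ v ∧ x ≠ w
    · exact ⟨x, hx, h1⟩
    by_cases h2 : y ≠ v ∧ y ≠ w
    · exact ⟨y, hy, h2⟩
    · refine ⟨z, hz, ?_⟩
      grind
  have huniv : ∀ v, v ∈ K := by
    refine hG.1.mem_of_closed hx fun v hv u₀ hvu₀ => ?_
    by_contra hu₀
    obtain ⟨w₀, hw₀, hw₀v, -⟩ := hthird v v
    set G' := G.deleteIncidenceSet v with hG'
    obtain ⟨⟨u, w⟩, ⟨hu, hvu, hw, hwv⟩, hmin⟩ := exists_minimalFor_of_wellFoundedLT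
      (fun s : V × V => s.1 ∉ K ∧ G.Adj v s.1 ∧ s.2 ∈ K ∧ s.2 ≠ v) (fun s => G'.dist s.1 s.2)
      ⟨(u₀, w₀), hu₀, hvu₀, hw₀, hw₀v⟩
    have hmin' : ∀ c ∈ K, c ≠ v → G'.dist u w ≤ G'.dist u c := by
      intro c hc hcv
      by_contra hlt
      exact hlt (hmin (j := (u, c)) ⟨hu, hvu, hc, hcv⟩ (not_le.1 hlt).le)
    dsimp only at hu hvu hw hwv
    have hreach := hG.2 v u w hvu.ne' hwv
    have huw : u ≠ w := fun h => hu (h ▸ hw)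
    obtain ⟨q, q0, ql, qadj, qd, qdist⟩ := hreach.exists_geodesic
    have hl1 : 0 < G'.dist u w := hreach.pos_dist_of_ne huw
    set l := G'.dist u w with hl
    have hqv : ∀ i ≤ l, q i ≠ v := fun i hi => (qd i hi).2.1.avoids hvu.ne'
    have hqK : ∀ i < l, q i ∉ K := fun i hi hiK => by
      have h1 := hmin' _ hiK (hqv i hi.le)
      have h2 : G'.dist u (q i) = i := (qd i hi.le).1
      omega
    rcases Nat.lt_or_ge 1 l with hl2 | hl2
    -- The geodesic from `w` back to `u`, closed through `v`, has no chord at `w`. Rotation ties the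
    -- colour of `v` to that of `q (l - 2)`, which lies outside `K`; a swap inside `K` that
    -- recolours `v` breaks this.
    · have hrot : ∀ φ, S w φ → φ (q (l - 2)) = φ v := by
        intro φ hφ
        have := (hS.rotate (φ := φ) hB ht (fun i => if i ≤ l then q (l - i) else v) (s := l + 1)
          (by omega) (by simpa [ql] using hφ) ?_ (by simpa [ql] using hK hv hw hwv.symm) ?_ ?_).1
        · simpa [show 2 ≤ l by omega] using this
        · intro i hi
          rcases Nat.lt_or_ge i l with hil | hil
          · simp only [hil.le, Nat.succ_le_of_lt hil, if_true]
            have := (G.deleteIncidenceSet_adj.1 (qadj (l - (i + 1)) (by omega))).1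
            rw [show l - (i + 1) + 1 = l - i by omega] at this
            exact this.symm
          · obtain rfl : i = l := by omega
            simpa [q0] using hvu.symm
        · have hqinj : ∀ i ≤ l, ∀ j ≤ l, q i = q j → i = j := by
            intro i hi j hj h
            have h1 : G'.dist u (q i) = i := (qd i hi).1
            have h2 : G'.dist u (q j) = j := (qd j hj).1
            rw [h, h2] at h1
            omega
          intro i hi j hj hij
          by_cases h1 : i ≤ l <;> by_cases h2 : j ≤ l <;> simp only [h1, h2, if_true, if_false] at hij
          · have := hqinj _ (by omega) _ (by omega) hij
            omega
          · exact absurd hij (hqv _ (by omega))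
          · exact absurd hij.symm (hqv _ (by omega))
          · omega
        · intro i h1 h2 hA
          have hil : i ≤ l := by omega
          simp only [hil, Nat.zero_le, if_true, Nat.sub_zero] at hA
          have h' : G'.Adj (q (l - i)) (q l) :=
            G.deleteIncidenceSet_adj.2 ⟨hA.symm, hqv _ (by omega), hqv _ (by omega)⟩
          have := qdist (l - i) l (by omega) le_rfl
          rw [dist_eq_one_iff_adj.2 h'] at this
          omega
      obtain ⟨c, hc, hcv, hcw⟩ := hthird v w
      obtain ⟨φ, h1, h2⟩ := hcol hw hv hwv.symm hcw hcv.symm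
      obtain ⟨ψ, s1, s2, s3, s4⟩ := hS.swap (hK hw hv hwv) (hK hv hc hcv.symm) (hK hc hw hcw) h1
      have hnK := hqK (l - 2) (by omega)
      have h3 := hrot ψ s1
      rw [s2, s4 _ (ne_of_mem_of_not_mem hw hnK).symm (ne_of_mem_of_not_mem hv hnK).symm
        (ne_of_mem_of_not_mem hc hnK).symm,
        hrot φ h1] at h3
      exact h2 h3
    · have huw' : G.Adj u w := by
        have := (G.deleteIncidenceSet_adj.1 (qadj 0 hl1)).1
        rwa [q0, show 0 + 1 = l by omega, ql] at this
      -- By maximality some `c` in `K` misses `u`. Rotating the 4-cycle `c v u w` in both directions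
      -- gives `u` the colours of both `v` and `w`, which can be made different.
      obtain ⟨c, hc, hcu⟩ : ∃ c ∈ K, ¬ G.Adj c u := by
        by_contra! hall
        have : G.IsClique (insert u K) := hK.insert fun b hb _ => (hall b hb).symm
        exact hu (hKmax.le_of_ge this (Set.subset_insert u K) (Set.mem_insert u K))
      have hcv : v ≠ c := fun h => hcu (h ▸ hvu)
      have hcw : w ≠ c := fun h => hcu (h ▸ huw'.symm)
      have hcu' : c ≠ u := fun h => hu (h ▸ hc)
      obtain ⟨φ, h1, h2⟩ := hcol hc hv hcv hcw hwv.symm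
      have a := hS.rotate_four hB ht (hK hc hv hcv.symm) hvu huw' (hK hw hc hcw) hwv.symm
        hcu hcu' h1
      have b := hS.rotate_four hB ht (hK hc hw hcw.symm) huw'.symm hvu.symm (hK hv hc hcv) hwv
        hcu hcu' h1
      exact h2 (b.symm.trans a)
  have hadj : ∀ a b, a ≠ b → G.Adj a b := fun a b hab => hK (huniv a) (huniv b) hab
  have heq : ∀ a v w, a ≠ v → a ≠ w → t a v = t a w := by
    intro a v w hv hw
    by_cases hvw : v = w
    · rw [hvw]
    obtain ⟨φ, h1, h2⟩ := hcol (huniv a) (huniv v) hv.symm hw.symm hvw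
    exact hS.rotate_three hB ht (hadj a v hv) (hadj v w hvw) (hadj w a hw.symm) h1 h2
  refine ⟨hadj, fun a b hab => ?_⟩
  by_cases hax : a = x
  · subst hax
    exact heq _ _ _ hab hxy.ne
  · rw [heq a b x hab hax, hsymm, heq x a y (Ne.symm hax) hxy.ne]

/-- A sliding system that shows two colours around some hole lives on a complete graph or an odd
cycle, with constant weight. -/
theorem complete_or_odd_cycle (hS : G.IsSliding S) (hG : G.NoCut) (hB : IsBalanced t S)
    (ht : ∀ x y, 0 < t x y ↔ G.Adj x y) (hsymm : ∀ x y, t x y = t y x) {x y z : V}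
    (hxy : G.Adj x y) (hxz : G.Adj x z) (h : S x φ) (hne : φ y ≠ φ z) :
    ∃ T, 1 ≤ T ∧ (∀ a b, G.Adj a b → t a b = T) ∧ ((∀ a b, a ≠ b → G.Adj a b) ∨
      ∃ k, 3 ≤ k ∧ Odd k ∧ ∃ p : ZMod k → V, G.IsInducedCycle p ∧ Function.Surjective p) := by
  obtain ⟨k, hk, p, hp, rfl, hpne⟩ := hG.exists_isInducedCycle hxy hxz hne
  have hodd := hp.odd_length hk hS hB ht h hpne
  rcases Nat.lt_or_ge k 5 with h5 | h5
  · obtain rfl : k = 3 := by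
      obtain ⟨m, rfl⟩ := hodd
      omega
    have h01 := hp.adj_succ 0
    have h12 := hp.adj_succ 1
    have h20 := hp.adj_succ (-1)
    rw [zero_add] at h01
    rw [show (1 : ZMod 3) + 1 = -1 by decide] at h12
    rw [neg_add_cancel] at h20
    obtain ⟨a, b⟩ := hS.complete hG hB ht hsymm h01 h12 h20 h hpne
    exact ⟨_, (ht _ _).2 h01, fun _ _ hab => b _ _ hab.ne, Or.inl a⟩
  · obtain ⟨-, hsurj, hT⟩ := hp.spanning h5 hG hS hB ht hsymm h hpne
    exact ⟨_, (ht _ _).2 (by simpa using hp.adj_succ 0), hT, Or.inr ⟨k, hk, hodd, p, hp, hsurj⟩⟩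

end IsSliding

end SimpleGraph

/-! ### Two colours somewhere are seen from every hole -/

namespace SimpleGraph.IsSliding

variable {V : Type*} {C : Type*} [DecidableEq V] {G : SimpleGraph V} {S : V → (V → C) → Prop}

/-- If the set of colours around the hole depends only on the hole and some position shows two
colours, then every hole sees two colours. -/
theorem exists_neighbors_ne (hS : G.IsSliding S) (hG : G.NoCut)
    (hpal : ∀ x φ ψ, S x φ → S x ψ → ∀ y, G.Adj x y → ∃ z, G.Adj x z ∧ φ z = ψ y)
    {x₀ y₀ z₀ : V} {φ₀ : V → C} (h₀ : S x₀ φ₀) (hy₀ : y₀ ≠ x₀) (hz₀ : z₀ ≠ x₀)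
    (hne : φ₀ y₀ ≠ φ₀ z₀) {x : V} {φ : V → C} (h : S x φ) :
    ∃ y z, G.Adj x y ∧ G.Adj x z ∧ φ y ≠ φ z := by
  by_contra! hall
  obtain ⟨y, hxy⟩ : ∃ y, G.Adj x y := by
    have hyz : y₀ ≠ z₀ := fun h => hne (h ▸ rfl)
    obtain ⟨w, hw⟩ : ∃ w, w ≠ x := by
      by_cases hx : y₀ = x
      · exact ⟨z₀, fun h => hyz (hx.trans h.symm)⟩
      · exact ⟨y₀, hx⟩
    obtain ⟨p⟩ := hG.1 x w
    cases p with
    | nil => exact absurd rfl hw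
    | cons hadj _ => exact ⟨_, hadj⟩
  -- Holes that see only the colour of `y`, in every position, propagate to neighbours. An ear from
  -- `z` through `w` back to `x` leaves the colour of `w` on `z`, where the hole `x` sees it.
  have hT : ∀ v, v ∈ {v | ∀ ψ, S v ψ → ∀ w, G.Adj v w → ψ w = φ y} := by
    refine hG.1.mem_of_closed (a := x) ?_ ?_
    · intro ψ hψ w hw
      obtain ⟨z, hz, hzw⟩ := hpal x φ ψ h hψ w hw
      rw [← hzw]
      exact hall _ _ hz hxy
    · intro x hx z hxz ψ hψ w hzw
      by_cases hwx : w = x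
      · subst hwx
        simpa using hx _ (hS _ _ _ hψ hxz.symm) z hxz
      · obtain ⟨v, hv, hvz, hear⟩ := hS.ear hG (A := {z, x}) (x := z) (w := x) (u := w)
          (by simp) (by simp) hxz.ne (by simp [hwx, hzw.ne']) hzw
        obtain rfl : v = x := by simpa [hvz] using hv
        obtain ⟨χ, h1, h2, -⟩ := hear ψ hψ
        rw [← h2]
        exact hx χ h1 z hxz
  obtain ⟨w, hw, hwc⟩ : ∃ w, w ≠ x₀ ∧ φ₀ w ≠ φ y := by
    by_cases hc : φ₀ y₀ = φ y
    · exact ⟨z₀, hz₀, fun h => hne (hc.trans h.symm)⟩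
    · exact ⟨y₀, hy₀, hc⟩
  have hreach := hG.1 x₀ w
  obtain ⟨q, q0, ql, qadj, qd, -⟩ := hreach.exists_geodesic
  have hl := hreach.pos_dist_of_ne hw.symm
  have hqinj : ∀ i ≤ G.dist x₀ w, ∀ j ≤ G.dist x₀ w, q i = q j → i = j := by
    intro i hi j hj h
    rw [← (qd i hi).1, ← (qd j hj).1, h]
  -- Stopping one step before `w` leaves its deviating colour in view of the hole.
  obtain ⟨ψ, h1, -, h3⟩ := hS.slide (φ := φ₀) q (G.dist x₀ w - 1) (by rwa [q0])
    (fun i hi => qadj i (by omega)) (fun i hi j hj => hqinj i (by omega) j (by omega))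
  apply hwc
  rw [← h3 w, hT _ ψ h1 w]
  · have := qadj (G.dist x₀ w - 1) (by omega)
    rwa [Nat.sub_add_cancel hl, ql] at this
  · intro i hi h
    have := hqinj i (by omega) _ le_rfl (by rw [ql, h])
    omega

end SimpleGraph.IsSliding

/-! ### Sliding systems on hypergraphs and bricks -/

namespace FinHypergraph

/-- Two distinct vertices are adjacent if they lie in a common edge. -/
def adjGraph (H : FinHypergraph.{u, v}) : SimpleGraph H.V where
  Adj x y := x ≠ y ∧ ∃ e, x ∈ H.inc e ∧ y ∈ H.inc e
  symm := ⟨fun _ _ h => ⟨h.1.symm, h.2.imp fun _ he => he.symm⟩⟩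
  loopless := ⟨fun _ h => h.1 rfl⟩

/-- The number of edges with set of ends `{x, y}`. -/
noncomputable def mult (H : FinHypergraph.{u, v}) (x y : H.V) : ℕ :=
  {e | H.inc e = {x, y}}.ncard

/-- The edges at `x` all of whose other ends have colour `c`. -/
def colorStar (H : FinHypergraph.{u, v}) {C : Type w} (φ : H.V → C) (x : H.V) (c : C) : Set H.E :=
  {e | x ∈ H.inc e ∧ ∀ y ∈ H.inc e, y ≠ x → φ y = c}

variable {H : FinHypergraph.{u, v}}

theorem exists_mem_ne (e : H.E) (x : H.V) : ∃ y ∈ H.inc e, y ≠ x :=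
  Set.exists_ne_of_one_lt_ncard (H.two_le_inc e) x

theorem mult_symm (x y : H.V) : H.mult x y = H.mult y x := by
  rw [mult, mult, Set.pair_comm]

theorem mult_pos_iff (h2 : ∀ e, ∃ x y, x ≠ y ∧ H.inc e = {x, y}) (x y : H.V) :
    0 < H.mult x y ↔ H.adjGraph.Adj x y := by
  rw [mult, Set.ncard_pos (Set.toFinite _)]
  constructor
  · rintro ⟨e, he⟩
    have he : H.inc e = {x, y} := he
    refine ⟨?_, e, by simp [he], by simp [he]⟩
    rintro rfl
    have := H.two_le_inc e
    rw [he, Set.pair_eq_singleton, Set.ncard_singleton] at this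
    omega
  · rintro ⟨hxy, e, hx, hy⟩
    obtain ⟨a, b, -, hab⟩ := h2 e
    refine ⟨e, ?_⟩
    rw [hab] at hx hy
    change H.inc e = {x, y}
    rw [hab]
    rcases hx with rfl | rfl <;> rcases hy with rfl | rfl
    · exact absurd rfl hxy
    · rfl
    · exact Set.pair_comm _ _
    · exact absurd rfl hxy

theorem sum_mult_eq_ncard_colorStar [Fintype H.V] {C : Type w} [DecidableEq C]
    (h2 : ∀ e, ∃ x y, x ≠ y ∧ H.inc e = {x, y}) (φ : H.V → C) (x : H.V) (c : C) :
    (∑ y, if φ y = c then H.mult x y else 0) = (H.colorStar φ x c).ncard := by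
  classical
  have : Fintype H.E := Fintype.ofFinite _
  have hm : ∀ y, H.mult x y = (Finset.univ.filter fun e => H.inc e = {x, y}).card := fun y => by
    rw [mult, Set.ncard_eq_toFinset_card']
    congr 1
    ext; simp
  rw [← Finset.sum_filter]
  simp_rw [hm]
  rw [← Finset.card_biUnion, Set.ncard_eq_toFinset_card']
  · congr 1
    ext e
    rw [Finset.mem_biUnion, Set.mem_toFinset]
    simp only [Finset.mem_filter, Finset.mem_univ, true_and]
    change _ ↔ x ∈ H.inc e ∧ ∀ y ∈ H.inc e, y ≠ x → φ y = c
    constructor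
    · rintro ⟨y, rfl, he⟩
      rw [he]
      refine ⟨by simp, fun z hz hzx => ?_⟩
      rcases hz with rfl | rfl
      · exact absurd rfl hzx
      · rfl
    · rintro ⟨hx, hc⟩
      obtain ⟨y, hy, hyx⟩ := exists_mem_ne e x
      refine ⟨y, hc y hy hyx, ?_⟩
      obtain ⟨a, b, -, hab⟩ := h2 e
      rw [hab] at hx hy ⊢
      rcases hx with rfl | rfl <;> rcases hy with rfl | rfl
      · exact absurd rfl hyx
      · rfl
      · exact Set.pair_comm _ _
      · exact absurd rfl hyx
  · intro y hy z hz hyz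
    rw [Function.onFun, Finset.disjoint_left]
    intro e he he'
    simp only [Finset.mem_filter, Finset.mem_univ, true_and] at he he'
    apply hyz
    have hn := H.two_le_inc e
    have h1 : y ∈ H.inc e := by rw [he]; simp
    have h2 : z ∈ H.inc e := by rw [he']; simp
    rw [he'] at h1
    rw [he] at h2
    rcases h1 with rfl | h1
    · rcases h2 with h2 | h2
      · exact h2.symm
      · exact h2.symm
    · exact h1

/-- Sending an edge to its pair of ends has fibres of size `T`, so each fibre can be numbered by
`Fin T`. -/
theorem nonempty_iso_multiply (h2 : ∀ e, ∃ x y, x ≠ y ∧ H.inc e = {x, y}) {α : Type u'}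
    [Finite α] (G : SimpleGraph α) (σ : H.V ≃ α)
    (hadj : ∀ x y, H.adjGraph.Adj x y ↔ G.Adj (σ x) (σ y)) {T : ℕ}
    (hT : ∀ x y, H.adjGraph.Adj x y → H.mult x y = T) :
    Nonempty (H.Iso (multiply T (ofSimpleGraph G))) := by
  have hg : ∀ e, ∃ s : G.edgeSet, {x | x ∈ (s : Sym2 α)} = σ '' H.inc e := by
    intro e
    obtain ⟨x, y, hxy, he⟩ := h2 e
    have hA : H.adjGraph.Adj x y := ⟨hxy, e, by simp [he], by simp [he]⟩
    refine ⟨⟨s(σ x, σ y), (hadj x y).1 hA⟩, ?_⟩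
    rw [he, Set.image_pair]
    ext; simp
  choose g hg using hg
  have hfib : ∀ s : G.edgeSet, Nat.card {e // g e = s} = T := by
    rintro ⟨s, hs⟩
    induction s with
    | _ a b =>
      have hab : H.adjGraph.Adj (σ.symm a) (σ.symm b) := (hadj _ _).2 (by simpa using hs)
      rw [← hT _ _ hab, mult, ← Nat.card_coe_set_eq]
      refine Nat.card_congr (Equiv.subtypeEquivRight fun e => ?_)
      have h1 : (g e = ⟨s(a, b), hs⟩) ↔ {x | x ∈ (g e : Sym2 α)} = {x | x ∈ s(a, b)} := by
        rw [Subtype.ext_iff]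
        constructor
        · intro h; rw [h]
        · intro h
          exact Sym2.ext fun x => Set.ext_iff.1 h x
      have h3 : {x | x ∈ s(a, b)} = σ '' {σ.symm a, σ.symm b} := by
        rw [Set.image_pair]; ext; simp
      rw [h1, hg, h3, (Set.image_injective.2 σ.injective).eq_iff]
      rfl
  refine ⟨⟨σ, ((Equiv.sigmaFiberEquiv g).symm.trans
    (Equiv.sigmaCongrRight fun s => Finite.equivFinOfCardEq (hfib s))).trans
    (Equiv.sigmaEquivProd _ _), fun e => hg e⟩⟩

/-- A hypergraph without cut vertices that carries a sliding system with two colours, in which all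
edges at the hole are monochromatic and the number of edges of each colour at the hole depends on
the hole only, is a brick. -/
theorem isBrick_of_isSliding [DecidableEq H.V] {C : Type w} {S : H.V → (H.V → C) → Prop}
    (hG : H.adjGraph.NoCut) (hS : H.adjGraph.IsSliding S)
    (hmono : ∀ x φ, S x φ → ∀ e, x ∈ H.inc e → ∀ y ∈ H.inc e, ∀ z ∈ H.inc e, y ≠ x → z ≠ x →
      φ y = φ z)
    (hcount : ∀ x φ ψ c, S x φ → S x ψ →
      (H.colorStar φ x c).ncard = (H.colorStar ψ x c).ncard)
    {x₀ y₀ z₀ : H.V} {φ₀ : H.V → C} (h₀ : S x₀ φ₀) (hy₀ : y₀ ≠ x₀) (hz₀ : z₀ ≠ x₀)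
    (hne : φ₀ y₀ ≠ φ₀ z₀) : H.IsBrick := by
  classical
  have : Fintype H.V := Fintype.ofFinite _
  have hpal : ∀ x φ ψ, S x φ → S x ψ → ∀ y, H.adjGraph.Adj x y →
      ∃ z, H.adjGraph.Adj x z ∧ φ z = ψ y := by
    rintro x φ ψ hφ hψ y ⟨hxy, e, hx, hy⟩
    have h1 : 0 < (H.colorStar ψ x (ψ y)).ncard := (Set.ncard_pos (Set.toFinite _)).2
      ⟨e, hx, fun z hz hzx => hmono x ψ hψ e hx z hz y hy hzx hxy.symm⟩
    rw [hcount x ψ φ _ hψ hφ, Set.ncard_pos (Set.toFinite _)] at h1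
    obtain ⟨e', hx', hc⟩ := h1
    obtain ⟨z, hz, hzx⟩ := exists_mem_ne e' x
    exact ⟨z, ⟨hzx.symm, e', hx', hz⟩, hc z hz hzx⟩
  have htwo : ∀ {x φ}, S x φ → ∃ y z, H.adjGraph.Adj x y ∧ H.adjGraph.Adj x z ∧ φ y ≠ φ z :=
    fun h => hS.exists_neighbors_ne hG hpal h₀ hy₀ hz₀ hne h
  have h2 : ∀ e, ∃ x y, x ≠ y ∧ H.inc e = {x, y} := by
    intro e
    rw [← Set.ncard_eq_two]
    refine le_antisymm ?_ (H.two_le_inc e)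
    by_contra! h3
    obtain ⟨a, b, c, ha, hb, hc, hab, hac, hbc⟩ := (Set.two_lt_ncard_iff (Set.toFinite _)).1 h3
    obtain ⟨φ, hφ⟩ := hS.exists_position hG.1 h₀ a
    obtain ⟨u, hu, hub⟩ : ∃ u, H.adjGraph.Adj a u ∧ φ u ≠ φ b := by
      obtain ⟨y, z, hy, hz, hyz⟩ := htwo hφ
      by_cases h : φ y = φ b
      · exact ⟨z, hz, fun h' => hyz (h.trans h'.symm)⟩
      · exact ⟨y, hy, h⟩
    -- With three vertices on `e`, an ear leaving `e` at `a` through `u` carries the colour of `u`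
    -- to `a` and returns to `e` at `y`. A third vertex `d` kept its colour, so `e` is no longer
    -- monochromatic off the hole.
    have hue : u ∉ H.inc e := fun h => hub (hmono a φ hφ e ha u h b hb hu.ne' hab.symm)
    obtain ⟨y, hy, hya, hear⟩ := hS.ear hG ha hb hab.symm hue hu
    obtain ⟨ψ, h1, h2, h4⟩ := hear φ hφ
    obtain ⟨d, hd, hda, hdy⟩ : ∃ d ∈ H.inc e, d ≠ a ∧ d ≠ y := by
      by_cases h : b = y
      · exact ⟨c, hc, hac.symm, fun h' => hbc (h.trans h'.symm)⟩
      · exact ⟨b, hb, hab.symm, h⟩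
    apply hub
    rw [← h2, hmono y ψ h1 e hy a ha d hd hya.symm hdy, h4 d hd hda hdy]
    exact hmono a φ hφ e ha d hd b hb hda hab.symm
  obtain ⟨y, z, hy, hz, hyz⟩ := htwo h₀
  have hB : SimpleGraph.IsBalanced H.mult S := by
    intro x φ ψ c hφ hψ
    rw [sum_mult_eq_ncard_colorStar h2, sum_mult_eq_ncard_colorStar h2]
    exact hcount x φ ψ c hφ hψ
  obtain ⟨T, hT1, hT, hK | ⟨k, hk, hodd, p, hp, hsurj⟩⟩ :=
    hS.complete_or_odd_cycle hG hB (mult_pos_iff h2) mult_symm hy hz h₀ hyz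
  · left
    have : Nonempty H.V := ⟨x₀⟩
    exact ⟨T, Nat.card H.V, hT1, Nat.card_pos, nonempty_iso_multiply h2 _ (Finite.equivFin H.V)
      (fun x y => by
        rw [SimpleGraph.top_adj, (Finite.equivFin H.V).injective.ne_iff]
        exact ⟨fun h => h.ne, hK x y⟩) hT⟩
  · right
    refine ⟨T, k, hT1, hk, hodd, ?_⟩
    obtain ⟨n, rfl⟩ : ∃ n, k = n + 2 := ⟨k - 2, by omega⟩
    let τ : ZMod (n + 2) ≃ H.V := Equiv.ofBijective p ⟨hp.injective, hsurj⟩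
    let σ : H.V ≃ Fin (n + 2) := τ.symm
    refine nonempty_iso_multiply h2 _ σ (fun x y => ?_) hT
    obtain ⟨i, rfl⟩ := τ.surjective x
    obtain ⟨j, rfl⟩ := τ.surjective y
    have hadj : ∀ a b : Fin (n + 2), (SimpleGraph.cycleGraph (n + 2)).Adj a b ↔
        b = a + 1 ∨ a = b + 1 := fun a b => by
      rw [SimpleGraph.cycleGraph_adj, or_comm, sub_eq_iff_eq_add', sub_eq_iff_eq_add']
    rw [show σ (τ i) = i from τ.symm_apply_apply i, show σ (τ j) = j from τ.symm_apply_apply j]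
    exact (hp.adj_iff i j).trans (hadj i j).symm

end FinHypergraph

/-! ### Hyperpaths, separating vertices and blocks -/

namespace FinHypergraph

variable {H : FinHypergraph.{u, v}}

theorem connected_iff : H.Connected ↔ Nonempty H.V ∧ H.adjGraph.Preconnected := by
  refine and_congr_right fun _ => forall_congr' fun x => forall_congr' fun y => ⟨?_, ?_⟩
  · rintro ⟨q, p, rfl, rfl⟩
    have : ∀ i, H.adjGraph.Reachable (p.vert 0) (p.vert i) := by
      intro i
      induction i using Fin.induction with
      | zero => exact SimpleGraph.Reachable.refl _
      | succ i ih =>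
        have hA : H.adjGraph.Adj (p.vert i.castSucc) (p.vert i.succ) :=
          ⟨p.vert_injective.ne (Fin.castSucc_lt_succ).ne, p.edge i, p.inc i (by simp),
            p.inc i (by simp)⟩
        exact ih.trans hA.reachable
    exact this _
  · intro h
    obtain ⟨q, q0, ql, qadj, qd, qdist⟩ := h.exists_geodesic
    have hadj : ∀ i : Fin (H.adjGraph.dist x y), ∃ e, q i ∈ H.inc e ∧ q (i + 1) ∈ H.inc e :=
      fun i => (qadj i i.2).2
    choose e he he' using hadj
    -- A repeated edge would put `q i` and `q (j + 1)` at distance at most 1, although they are at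
    -- least 2 apart on the geodesic.
    have hlt : ∀ i j, e i = e j → ¬ i < j := by
      intro i j hij hlt
      have h1 : H.adjGraph.dist (q i) (q (j + 1)) = j + 1 - i := qdist _ _ (by omega) (by omega)
      by_cases hq : q i = q (j + 1)
      · rw [hq, SimpleGraph.dist_self] at h1
        omega
      · have hA : H.adjGraph.Adj (q i) (q (j + 1)) := ⟨hq, e i, he i, hij ▸ he' j⟩
        rw [SimpleGraph.dist_eq_one_iff_adj.2 hA] at h1
        omega
    refine ⟨_, ⟨fun i => q i, e, ?_, ?_, ?_⟩, by simpa using q0, by simpa using ql⟩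
    · intro i j hij
      have h1 := (qd i (by omega)).1
      have h2 := (qd j (by omega)).1
      have h3 : q i = q j := hij
      rw [h3, h2] at h1
      exact Fin.ext h1.symm
    · intro i j hij
      exact le_antisymm (not_lt.1 (hlt j i hij.symm)) (not_lt.1 (hlt i j hij))
    · rintro i v (rfl | rfl)
      · exact he i
      · exact he' i

theorem not_isSeparating_iff {z : H.V} : ¬ H.IsSeparating z ↔
    ∀ a b, a ≠ z → b ≠ z → (H.adjGraph.deleteIncidenceSet z).Reachable a b := by
  constructor
  · intro hz a b ha hb
    by_contra hab
    apply hz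
    -- Split at `z` into the component of `a` and the rest; an edge in neither part would join the
    -- two without using `z`.
    refine ⟨{z} ∪ {c | c ≠ z ∧ (H.adjGraph.deleteIncidenceSet z).Reachable a c},
      {z} ∪ {c | c ≠ z ∧ ¬ (H.adjGraph.deleteIncidenceSet z).Reachable a c}, ?_, ?_, ?_, ?_, ?_⟩
    · ext c
      by_cases hc : c = z <;> by_cases hr : (H.adjGraph.deleteIncidenceSet z).Reachable a c <;>
        simp [hc, hr]
    · refine Set.eq_univ_of_forall fun e => ?_
      by_contra hnot
      rw [Set.mem_union, not_or] at hnot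
      obtain ⟨c, hc, hc'⟩ := Set.not_subset.1 hnot.1
      obtain ⟨d, hd, hd'⟩ := Set.not_subset.1 hnot.2
      simp only [Set.mem_union, Set.mem_singleton_iff, Set.mem_ofPred_eq, not_or, not_and,
        not_not] at hc' hd'
      have hdr := hd'.2 hd'.1
      have hcr := hc'.2 hc'.1
      refine hcr (hdr.trans (SimpleGraph.Adj.reachable ?_))
      refine H.adjGraph.deleteIncidenceSet_adj.2 ⟨⟨?_, e, hd, hc⟩, hd'.1, hc'.1⟩
      rintro rfl
      exact hcr hdr
    · ext c
      by_cases hc : c = z <;> by_cases hr : (H.adjGraph.deleteIncidenceSet z).Reachable a c <;>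
        simp [hc, hr]
    · rw [← Set.ncard_pair ha]
      refine Set.ncard_le_ncard ?_
      rintro c (rfl | rfl)
      · exact Or.inr ⟨ha, SimpleGraph.Reachable.refl _⟩
      · exact Or.inl rfl
    · rw [← Set.ncard_pair hb]
      refine Set.ncard_le_ncard ?_
      rintro c (rfl | rfl)
      · exact Or.inr ⟨hb, hab⟩
      · exact Or.inl rfl
  · rintro h ⟨X, Y, -, hE, hXY, hX, hY⟩
    obtain ⟨a, haX, ha⟩ := Set.exists_ne_of_one_lt_ncard hX z
    obtain ⟨b, hbY, hb⟩ := Set.exists_ne_of_one_lt_ncard hY z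
    have hdisj : ∀ c, c ∈ X → c ∈ Y → c = z := fun c h1 h2 => by
      have : c ∈ X ∩ Y := ⟨h1, h2⟩
      rwa [hXY] at this
    obtain ⟨w⟩ := h a b ha hb
    refine hb (hdisj b ?_ hbY)
    clear hbY hb
    induction w with
    | nil => exact haX
    | cons hadj _ ih =>
      obtain ⟨⟨hne, e, h1, h2⟩, h3, h4⟩ := H.adjGraph.deleteIncidenceSet_adj.1 hadj
      have he : e ∈ (H.inducedSub X).edges ∪ (H.inducedSub Y).edges := hE ▸ Set.mem_univ e
      rcases he with he | he
      · exact ih (he h2) h4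
      · exact absurd (hdisj _ haX (he h1)) h3

theorem noCut_iff : (H.Connected ∧ ∀ x, ¬ H.IsSeparating x) ↔
    Nonempty H.V ∧ H.adjGraph.NoCut := by
  simp only [connected_iff, not_isSeparating_iff, SimpleGraph.NoCut, and_assoc]

/-- Every edge with two vertices in a block belongs to the block. -/
theorem IsBlock.mem_edges {B : H.Sub} (hB : H.IsBlock B) {e : H.E} {x y : H.V} (hxy : x ≠ y)
    (hx : x ∈ B.verts) (hy : y ∈ B.verts) (hxe : x ∈ H.inc e) (hye : y ∈ H.inc e) :
    e ∈ B.edges := by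
  obtain ⟨-, hG⟩ := noCut_iff.1 hB.prop
  let B' : H.Sub :=
    { verts := B.verts ∪ H.inc e
      edges := insert e B.edges
      inc_subset := by
        rintro f (rfl | hf)
        · exact Set.subset_union_right
        · exact (B.inc_subset f hf).trans Set.subset_union_left }
  have hle : B ≤ B' := ⟨Set.subset_union_left, Set.subset_insert _ _⟩
  let ι : B.coe.V → B'.coe.V := fun a => ⟨a.1, hle.1 a.2⟩
  let e' : B'.coe.E := ⟨e, Set.mem_insert _ _⟩
  have hinj : ∀ a b, ι a = ι b → a = b := fun a b h =>
    Subtype.ext (congrArg (Subtype.val : B'.verts → H.V) h)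
  have hι : ∀ a b, B.coe.adjGraph.Adj a b → B'.coe.adjGraph.Adj (ι a) (ι b) := by
    rintro a b ⟨hne, f, ha, hb⟩
    exact ⟨fun h => hne (hinj _ _ h), ⟨f.1, hle.2 f.2⟩, ha, hb⟩
  let x' : B.coe.V := ⟨x, hx⟩
  let y' : B.coe.V := ⟨y, hy⟩
  have hpre : B'.coe.adjGraph.Preconnected := by
    have hone : ∀ c, B'.coe.adjGraph.Reachable (ι x') c := by
      rintro ⟨c, hc | hc⟩
      · exact (hG.1 x' ⟨c, hc⟩).map ⟨ι, fun h => hι _ _ h⟩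
      · by_cases hcx : (ι x') = ⟨c, Or.inr hc⟩
        · rw [← hcx]
        · exact SimpleGraph.Adj.reachable ⟨hcx, e', hxe, hc⟩
    exact fun a b => (hone a).symm.trans (hone b)
  have hcut : ∀ z a b, a ≠ z → b ≠ z → (B'.coe.adjGraph.deleteIncidenceSet z).Reachable a b := by
    intro z a b ha hb
    -- The edge `e` meets the block in two vertices, so after deleting `z` one of them still
    -- attaches the ends of `e` to the block.
    obtain ⟨w, hwe, hwz⟩ : ∃ w : B.coe.V, w.1 ∈ H.inc e ∧ ι w ≠ z := by
      by_cases h : ι x' = z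
      · refine ⟨y', hye, fun h' => hxy ?_⟩
        exact congrArg (Subtype.val : B'.verts → H.V) (h.trans h'.symm)
      · exact ⟨x', hxe, h⟩
    have hone : ∀ c, c ≠ z → (B'.coe.adjGraph.deleteIncidenceSet z).Reachable (ι w) c := by
      rintro ⟨c, hc | hc⟩ hcz
      · by_cases hz : ∃ z', ι z' = z
        · obtain ⟨z', rfl⟩ := hz
          refine (hG.2 z' w ⟨c, hc⟩ (fun h => hwz (h ▸ rfl)) (fun h => hcz (h ▸ rfl))).map
            ⟨ι, fun {a b} h => ?_⟩
          obtain ⟨h1, h2, h3⟩ := B.coe.adjGraph.deleteIncidenceSet_adj.1 h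
          exact B'.coe.adjGraph.deleteIncidenceSet_adj.2
            ⟨hι _ _ h1, fun h => h2 (hinj _ _ h), fun h => h3 (hinj _ _ h)⟩
        · refine (hG.1 w ⟨c, hc⟩).map ⟨ι, fun {a b} h => ?_⟩
          exact B'.coe.adjGraph.deleteIncidenceSet_adj.2
            ⟨hι _ _ h, fun h => hz ⟨_, h⟩, fun h => hz ⟨_, h⟩⟩
      · by_cases hcw : (ι w) = ⟨c, Or.inr hc⟩
        · rw [← hcw]
        · refine SimpleGraph.Adj.reachable (B'.coe.adjGraph.deleteIncidenceSet_adj.2 ?_)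
          exact ⟨⟨hcw, e', hwe, hc⟩, hwz, hcz⟩
    exact (hone a ha).symm.trans (hone b hb)
  exact (hB.le_of_ge (noCut_iff.2 ⟨⟨ι x'⟩, hpre, hcut⟩) hle).2 (Set.mem_insert _ _)

theorem isBrick_of_subsingleton [Subsingleton H.V] [Nonempty H.V] : H.IsBrick := by
  have hE : ∀ e : H.E, False := fun e => by
    obtain ⟨x⟩ := ‹Nonempty H.V›
    obtain ⟨y, -, hy⟩ := exists_mem_ne e x
    exact hy (Subsingleton.elim _ _)
  refine Or.inl ⟨1, 1, le_rfl, le_rfl, nonempty_iso_multiply (fun e => (hE e).elim) _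
    (Finite.equivFinOfCardEq (Nat.card_unique)) (fun x y => ?_) fun x y h => ?_⟩
  · simp [Subsingleton.elim x y]
  · exact absurd (Subsingleton.elim x y) h.ne

end FinHypergraph

/-! ### Smooth properties and minimal non-members -/

namespace FinHypergraph

def Iso.symm {H : FinHypergraph.{u, v}} {H' : FinHypergraph.{u', v'}} (i : H.Iso H') :
    H'.Iso H where
  onV := i.onV.symm
  onE := i.onE.symm
  inc_eq e := by
    have := i.inc_eq (i.onE.symm e)
    rw [Equiv.apply_symm_apply] at this
    rw [this, Equiv.symm_image_image]

variable {H : FinHypergraph.{u, v}} {P : FinHypergraph.{u, v} → Prop}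

theorem nonempty_iso_induce {K : FinHypergraph.{u', v'}} {f : K.V → H.V}
    (hf : Function.Injective f) {g : K.E → H.E} (hg : Function.Injective g)
    (hinc : ∀ e, H.inc (g e) = f '' K.inc e)
    (hsurj : ∀ e, H.inc e ⊆ Set.range f → e ∈ Set.range g) :
    Nonempty (K.Iso (H.induce (Set.range f))) := by
  refine ⟨⟨Equiv.ofInjective f hf, Equiv.ofBijective
    (fun e => ⟨g e, by
      change H.inc (g e) ⊆ _
      rw [hinc]
      exact Set.image_subset_range _ _⟩)
    ⟨fun a b h => hg (Subtype.ext_iff.1 h), ?_⟩, ?_⟩⟩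
  · rintro ⟨e, he⟩
    obtain ⟨e', rfl⟩ := hsurj e he
    exact ⟨e', rfl⟩
  · intro e
    change Subtype.val ⁻¹' H.inc (g e) = _
    rw [hinc]
    ext ⟨_, x, rfl⟩
    constructor
    · rintro ⟨y, hy, hyx⟩
      exact ⟨y, hy, Subtype.ext hyx⟩
    · rintro ⟨y, hy, hyx⟩
      exact ⟨y, hy, Subtype.ext_iff.1 hyx⟩

namespace IsSmooth

theorem induce_induce_iff (hP : IsSmooth P) (A : Set H.V) (Y : Set A) :
    P ((H.induce A).induce Y) ↔ P (H.induce (Subtype.val '' Y)) := by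
  have : Nonempty (((H.induce A).induce Y).Iso (H.induce (Subtype.val '' Y))) := by
    have h := nonempty_iso_induce (H := H) (K := (H.induce A).induce Y)
      (f := fun y : Y => y.1.1) (g := fun e => e.1.1)
      (Subtype.val_injective.comp Subtype.val_injective)
      (Subtype.val_injective.comp Subtype.val_injective) (fun e => ?_) (fun e he => ?_)
    · have hr : Set.range (fun y : Y => (y.1.1 : H.V)) = Subtype.val '' Y := by ext; simp
      rw [← hr]
      exact h
    · have h1 : H.inc e.1.1 ⊆ A := e.1.2
      have h2 : Subtype.val ⁻¹' H.inc e.1.1 ⊆ Y := e.2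
      ext x
      constructor
      · intro hx
        exact ⟨⟨⟨x, h1 hx⟩, h2 hx⟩, hx, rfl⟩
      · rintro ⟨y, hy, rfl⟩
        exact hy
    · have h1 : H.inc e ⊆ A := fun x hx => by
        obtain ⟨y, rfl⟩ := he hx
        exact y.1.2
      have h2 : Subtype.val ⁻¹' H.inc e ⊆ Y := fun x hx => by
        obtain ⟨y, hy⟩ := he hx
        rw [← Subtype.ext hy]
        exact y.2
      exact ⟨⟨⟨e, h1⟩, h2⟩, rfl⟩
  exact ⟨hP.iso_closed _ _ this, hP.iso_closed _ _ (this.map Iso.symm)⟩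

theorem induce_univ_iff (hP : IsSmooth P) : P (H.induce Set.univ) ↔ P H := by
  have : Nonempty (H.Iso (H.induce (Set.range (id : H.V → H.V)))) :=
    nonempty_iso_induce Function.injective_id (g := id) Function.injective_id
      (fun e => by simp) (fun e _ => ⟨e, rfl⟩)
  rw [Set.range_id] at this
  exact ⟨hP.iso_closed _ _ (this.map Iso.symm), hP.iso_closed _ _ this⟩

theorem induce_mono (hP : IsSmooth P) {A Z : Set H.V} (hZ : Z ⊆ A) (h : P (H.induce A)) :
    P (H.induce Z) := by
  have := (hP.induce_induce_iff A (Subtype.val ⁻¹' Z)).1 (hP.hereditary _ _ h)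
  rwa [Subtype.image_preimage_coe, Set.inter_eq_right.2 hZ] at this

theorem induce_empty (hP : IsSmooth P) : P (H.induce ∅) := by
  obtain ⟨K, hK, -⟩ := hP.exists_nonempty
  refine hP.iso_closed _ _ ?_ (hP.hereditary K ∅ hK)
  have hE : ∀ (K : FinHypergraph.{u, v}) (e : (K.induce ∅).E), False := fun K e => by
    have h2 := (K.induce ∅).two_le_inc e
    obtain ⟨x, -⟩ := Set.nonempty_of_ncard_ne_zero (s := (K.induce ∅).inc e) (by omega)
    exact x.2
  exact ⟨⟨⟨fun x => x.2.elim, fun x => x.2.elim, fun x => x.2.elim, fun x => x.2.elim⟩,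
    ⟨fun e => (hE _ e).elim, fun e => (hE _ e).elim, fun e => (hE _ e).elim,
      fun e => (hE _ e).elim⟩, fun e => (hE _ e).elim⟩⟩

/-- A vertex set that does not induce a member of `P` contains one that induces a member of
`F(P)`. -/
theorem exists_subset_not (hP : IsSmooth P) {A : Set H.V} (h : ¬ P (H.induce A)) :
    ∃ Z ⊆ A, ¬ P (H.induce Z) ∧
      ∀ x ∈ Z, dMin P ≤ {e | x ∈ H.inc e ∧ H.inc e ⊆ Z}.ncard := by
  obtain ⟨Z, hZA, hZ⟩ := (Set.toFinite {Z : Set H.V | ¬ P (H.induce Z)}).exists_le_minimal h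
  refine ⟨Z, hZA, hZ.prop, fun x hx => ?_⟩
  have hmin : MinForbidden P (H.induce Z) := by
    refine ⟨hZ.prop, fun (x : Z) => (hP.induce_induce_iff Z ({x}ᶜ : Set Z)).2 ?_⟩
    by_contra hnot
    have hx := hZ.le_of_le hnot (Subtype.coe_image_subset _ _) x.2
    obtain ⟨y, hy, hyx⟩ := hx
    exact hy (Subtype.ext hyx)
  calc dMin P ≤ (H.induce Z).minDegree := Nat.sInf_le ⟨_, hmin, rfl⟩
    _ ≤ (H.induce Z).degree ⟨x, hx⟩ := ciInf_le (OrderBot.bddBelow _) _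
    _ = _ := by
      change Set.ncard {e : {e | H.inc e ⊆ Z} | x ∈ H.inc e.1} = _
      rw [← Set.ncard_image_of_injective _ Subtype.val_injective]
      congr 1
      ext e
      constructor
      · rintro ⟨e, he, rfl⟩
        exact ⟨he, e.2⟩
      · rintro ⟨h1, h2⟩
        exact ⟨⟨e, h2⟩, h1, rfl⟩

/-- A minimal non-member inside `insert x A` must contain `x`, as subsets of `A` induce members of
`P`. -/
theorem dMin_le_ncard (hP : IsSmooth P) {A : Set H.V} {x : H.V} (hA : P (H.induce A))
    (h : ¬ P (H.induce (insert x A))) :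
    dMin P ≤ {e | x ∈ H.inc e ∧ H.inc e ⊆ insert x A}.ncard := by
  obtain ⟨Z, hZ, hZP, hd⟩ := hP.exists_subset_not h
  have hx : x ∈ Z := by
    by_contra hx
    exact hZP (hP.induce_mono (fun z hz => (hZ hz).resolve_left fun h => hx (h ▸ hz)) hA)
  exact (hd x hx).trans (Set.ncard_le_ncard fun e he => ⟨he.1, he.2.trans hZ⟩)

end IsSmooth

/-! ### Colorings with one hole in a critical hypergraph -/

/-- `φ`, read off `x`, is a `(P, L)`-coloring of `H - x`. -/
def IsColoringOff (P : FinHypergraph.{u, v} → Prop) (H : FinHypergraph.{u, v}) {C : Type w}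
    (L : H.V → Set C) (x : H.V) (φ : H.V → C) : Prop :=
  (∀ y, y ≠ x → φ y ∈ L y) ∧ ∀ c, P (H.induce {y | y ≠ x ∧ φ y = c})

variable {C : Type w} {L : H.V → Set C} {φ ψ : H.V → C} {x y : H.V}

theorem colorStar_disjoint {c d : C} {e : H.E} (hc : e ∈ H.colorStar φ x c)
    (hd : e ∈ H.colorStar φ x d) : c = d := by
  obtain ⟨y, hy, hyx⟩ := exists_mem_ne e x
  rw [← hc.2 y hy hyx, hd.2 y hy hyx]

namespace IsColoringOff

theorem dMin_le_ncard_colorStar (hP : IsSmooth P) (hcol : ¬ Colorable P H L)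
    (h : IsColoringOff P H L x φ) {c : C} (hc : c ∈ L x) :
    dMin P ≤ (H.colorStar φ x c).ncard := by
  classical
  have hnot : ¬ P (H.induce (insert x {y | y ≠ x ∧ φ y = c})) := by
    intro hPc
    refine hcol ⟨Function.update φ x c, fun y => ?_, fun d => ?_⟩
    · by_cases hy : y = x
      · subst hy; simpa using hc
      · simpa [hy] using h.1 y hy
    · by_cases hd : d = c
      · subst hd
        refine hP.induce_mono (fun y hy => ?_) hPc
        by_cases hyx : y = x
        · exact Or.inl hyx
        · exact Or.inr ⟨hyx, by simpa [hyx] using hy⟩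
      · refine hP.induce_mono (fun y hy => ?_) (h.2 d)
        have hyx : y ≠ x := by
          rintro rfl
          exact hd (by simpa using hy.symm)
        exact ⟨hyx, by simpa [hyx] using hy⟩
  refine (hP.dMin_le_ncard (h.2 c) hnot).trans (Set.ncard_le_ncard fun e he => ⟨he.1, ?_⟩)
  exact fun y hy hyx => ((he.2 hy).resolve_left hyx).2

/-- Equality in a count: the stars for colours in `L x` are pairwise disjoint, each has at least
`dMin P` edges, and lowness allows no more than that in total. -/
theorem low_colorStar (hP : IsSmooth P) (hcol : ¬ Colorable P H L) (h : IsColoringOff P H L x φ)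
    (hx : x ∈ lowVerts P H L) :
    (∀ c ∈ L x, (H.colorStar φ x c).ncard = dMin P) ∧
      ∀ e, x ∈ H.inc e → ∃ c ∈ L x, e ∈ H.colorStar φ x c := by
  classical
  have hx : (H.degree x : ℕ∞) = (dMin P : ℕ∞) * (L x).encard := hx
  have hle : ∀ c ∈ L x, dMin P ≤ (H.colorStar φ x c).ncard := fun c hc =>
    h.dMin_le_ncard_colorStar hP hcol hc
  have hsub : ∀ c, H.colorStar φ x c ⊆ {e | x ∈ H.inc e} := fun c e he => he.1
  -- Here the list may be infinite, as 0 times infinity is 0; otherwise lowness makes it finite.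
  by_cases hr : dMin P = 0
  · have h0 : {e : H.E | x ∈ H.inc e} = ∅ := by
      rw [hr] at hx
      have hx : H.degree x = 0 := by simpa using hx
      rwa [← Set.ncard_eq_zero (Set.toFinite _)]
    refine ⟨fun c _ => ?_, fun e he => ?_⟩
    · rw [hr, Set.ncard_eq_zero (Set.toFinite _), ← Set.subset_empty_iff, ← h0]
      exact hsub c
    · have : e ∈ {e : H.E | x ∈ H.inc e} := he
      rw [h0] at this
      exact this.elim
  have hfin : (L x).Finite := by
    rw [← Set.encard_ne_top_iff]
    intro htop
    rw [htop, ENat.mul_top (by simpa using hr)] at hx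
    exact ENat.natCast_ne_top _ hx
  obtain ⟨s, hs⟩ := hfin.exists_finset_coe
  have hdeg : H.degree x = dMin P * s.card := by
    rw [← hs, Set.encard_coe_eq_coe_finsetCard] at hx
    exact_mod_cast hx
  have hms : ∀ c, c ∈ s ↔ c ∈ L x := fun c => by rw [← hs]; rfl
  have : Fintype H.E := Fintype.ofFinite _
  let F : C → Finset H.E := fun c => (H.colorStar φ x c).toFinset
  have hF : ∀ c, (F c).card = (H.colorStar φ x c).ncard := fun c =>
    (Set.ncard_eq_toFinset_card' _).symm
  let D : Finset H.E := Set.toFinset {e | x ∈ H.inc e}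
  have hD : D.card = dMin P * s.card := by
    rw [← hdeg, degree, Set.ncard_eq_toFinset_card']
  have hUD : s.biUnion F ⊆ D := by
    intro e he
    obtain ⟨c, -, hc⟩ := Finset.mem_biUnion.1 he
    exact Set.mem_toFinset.2 (hsub c (Set.mem_toFinset.1 hc))
  have hU : (s.biUnion F).card = ∑ c ∈ s, (F c).card := by
    refine Finset.card_biUnion fun c _ d _ hcd => ?_
    rw [Function.onFun, Finset.disjoint_left]
    intro e hc hd
    exact hcd (colorStar_disjoint (Set.mem_toFinset.1 hc) (Set.mem_toFinset.1 hd))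
  have hsum : ∑ c ∈ s, dMin P = dMin P * s.card := by
    rw [Finset.sum_const, smul_eq_mul, mul_comm]
  have hle' : ∀ c ∈ s, dMin P ≤ (F c).card := fun c hc => by
    rw [hF]; exact hle c ((hms c).1 hc)
  have h1 := Finset.sum_le_sum hle'
  have h2 := Finset.card_le_card hUD
  refine ⟨fun c hc => ?_, fun e he => ?_⟩
  · have := (Finset.sum_eq_sum_iff_of_le hle').1 (by omega) c ((hms c).2 hc)
    rw [← hF, this]
  · have heq : s.biUnion F = D := Finset.eq_of_subset_of_card_le hUD (by omega)
    have : e ∈ s.biUnion F := heq ▸ Set.mem_toFinset.2 he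
    obtain ⟨c, hc, hec⟩ := Finset.mem_biUnion.1 this
    exact ⟨c, (hms c).1 hc, Set.mem_toFinset.1 hec⟩

theorem slide [DecidableEq H.V] (hP : IsSmooth P) (hcol : ¬ Colorable P H L)
    (h : IsColoringOff P H L x φ) (hx : x ∈ lowVerts P H L) (hxy : x ≠ y) {e : H.E}
    (hxe : x ∈ H.inc e) (hye : y ∈ H.inc e) :
    IsColoringOff P H L y (Function.update φ x (φ y)) := by
  obtain ⟨hstar, hmono⟩ := h.low_colorStar hP hcol hx
  obtain ⟨c, hc, hec⟩ := hmono e hxe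
  obtain rfl : φ y = c := hec.2 y hye hxy.symm
  refine ⟨fun z hz => ?_, fun d => ?_⟩
  · by_cases hzx : z = x
    · subst hzx; simpa using hc
    · simpa [hzx] using h.1 z hzx
  by_cases hd : d = φ y
  · subst hd
    by_contra hnot
    have hsub : {z | z ≠ y ∧ Function.update φ x (φ y) z = φ y} ⊆
        insert x {z | (z ≠ x ∧ φ z = φ y) ∧ z ≠ y} := by
      rintro z ⟨hz, hzc⟩
      by_cases hzx : z = x
      · exact Or.inl hzx
      · exact Or.inr ⟨⟨hzx, by simpa [hzx] using hzc⟩, hz⟩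
    have h1 := hP.dMin_le_ncard (x := x)
      (hP.induce_mono (fun z hz => hz.1) (h.2 (φ y)))
      (fun h => hnot (hP.induce_mono hsub h))
    -- If the new class were outside `P`, `dMin P` edges at `x` would lie in it. They belong to a
    -- star of exactly that size but omit `e`, which contains the new hole `y`.
    have h2 : {e | x ∈ H.inc e ∧ H.inc e ⊆ insert x {z | (z ≠ x ∧ φ z = φ y) ∧ z ≠ y}} ⊂
        H.colorStar φ x (φ y) := by
      refine ⟨fun f hf => ⟨hf.1, fun z hz hzx => ((hf.2 hz).resolve_left hzx).1.2⟩, fun hss => ?_⟩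
      rcases (hss hec).2 hye with h | h
      · exact hxy h.symm
      · exact h.2 rfl
    have h3 := Set.ncard_lt_ncard h2
    rw [hstar _ hc] at h3
    omega
  · refine hP.induce_mono (fun z hz => ?_) (h.2 d)
    have hzx : z ≠ x := by
      rintro rfl
      exact hd (by simpa using hz.2.symm)
    exact ⟨hzx, by simpa [hzx] using hz.2⟩

end IsColoringOff

theorem Critical.exists_isColoringOff (hP : IsSmooth P) (hcrit : Critical P H L) (x : H.V)
    (hxy : x ≠ y) : ∃ φ, IsColoringOff P H L x φ := by
  classical
  obtain ⟨φ, hL, hφ⟩ := hcrit.1 x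
  -- The value at the hole is irrelevant; it is borrowed from `y`, since `C` alone need not provide
  -- one.
  refine ⟨fun z => if h : z = x then φ ⟨y, hxy.symm⟩ else φ ⟨z, h⟩, fun z hz => ?_, fun c => ?_⟩
  · simpa [hz] using hL ⟨z, hz⟩
  · have := (hP.induce_induce_iff _ _).1 (hφ c)
    refine hP.induce_mono (fun z hz => ?_) this
    have hc := hz.2
    simp only [hz.1, dite_false] at hc
    exact ⟨⟨z, hz.1⟩, hc, rfl⟩

/-- The Gallai-type dichotomy for a hypergraph `K` without cut vertices sitting on low vertices of
a critical hypergraph. -/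
theorem Critical.isBrick_or_degree_le (hP : IsSmooth P) (hcrit : Critical P H L)
    {K : FinHypergraph.{u', v'}} {ι : K.V → H.V} (hι : Function.Injective ι) {κ : K.E → H.E}
    (hκ : Function.Injective κ) (hinc : ∀ e x, x ∈ K.inc e ↔ ι x ∈ H.inc (κ e))
    (hfull : ∀ e x y, x ≠ y → ι x ∈ H.inc e → ι y ∈ H.inc e → e ∈ Set.range κ)
    (hlow : ∀ x, ι x ∈ lowVerts P H L) [hne : Nonempty K.V] (hG : K.adjGraph.NoCut) :
    K.IsBrick ∨ ∀ x, K.degree x ≤ dMin P := by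
  classical
  by_cases hsub : Subsingleton K.V
  · exact Or.inl isBrick_of_subsingleton
  rw [not_subsingleton_iff_nontrivial] at hsub
  obtain ⟨x₀, y₀, hxy₀⟩ := exists_pair_ne K.V
  obtain ⟨Φ₀, hΦ₀⟩ := hcrit.exists_isColoringOff hP (ι x₀) (hι.ne hxy₀)
  -- Positions are traces on `K` of colorings that agree with the fixed `Φ₀` outside `K`; this
  -- freezing makes the counts depend on the hole only.
  let S : K.V → (K.V → C) → Prop := fun x φ =>
    ∃ Φ, IsColoringOff P H L (ι x) Φ ∧ (∀ y, Φ (ι y) = φ y) ∧ ∀ v ∉ Set.range ι, Φ v = Φ₀ v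
  have h₀ : S x₀ (Φ₀ ∘ ι) := ⟨Φ₀, hΦ₀, fun _ => rfl, fun _ _ => rfl⟩
  have hS : K.adjGraph.IsSliding S := by
    rintro x y φ ⟨Φ, h1, h2, h3⟩ ⟨hxy, e, hx, hy⟩
    refine ⟨_, h1.slide hP hcrit.2 (hlow x) (hι.ne hxy) ((hinc e x).1 hx) ((hinc e y).1 hy),
      fun z => ?_, fun v hv => ?_⟩
    · by_cases hz : z = x
      · subst hz; simp [h2]
      · simp [hz, hι.ne hz, h2]
    · rw [Function.update_of_ne (fun h => hv ⟨x, h.symm⟩), h3 v hv]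
  have himage : ∀ x φ Φ c, IsColoringOff P H L (ι x) Φ → (∀ y, Φ (ι y) = φ y) →
      κ '' K.colorStar φ x c = H.colorStar Φ (ι x) c ∩ Set.range κ := by
    intro x φ Φ c h1 h2
    ext e
    constructor
    · rintro ⟨e, ⟨hx, he⟩, rfl⟩
      refine ⟨?_, e, rfl⟩
      obtain ⟨d, -, hd⟩ := (h1.low_colorStar hP hcrit.2 (hlow x)).2 _ ((hinc e x).1 hx)
      obtain ⟨y, hy, hyx⟩ := exists_mem_ne e x
      have : d = c := by rw [← he y hy hyx, ← h2, hd.2 _ ((hinc e y).1 hy) (hι.ne hyx)]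
      exact this ▸ hd
    · rintro ⟨he, e, rfl⟩
      refine ⟨e, ⟨(hinc e x).2 he.1, fun y hy hyx => ?_⟩, rfl⟩
      rw [← h2]
      exact he.2 _ ((hinc e y).1 hy) (hι.ne hyx)
  have hmono : ∀ x φ, S x φ → ∀ e, x ∈ K.inc e → ∀ y ∈ K.inc e, ∀ z ∈ K.inc e, y ≠ x → z ≠ x →
      φ y = φ z := by
    rintro x φ ⟨Φ, h1, h2, -⟩ e hx y hy z hz hyx hzx
    obtain ⟨d, -, hd⟩ := (h1.low_colorStar hP hcrit.2 (hlow x)).2 _ ((hinc e x).1 hx)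
    rw [← h2, ← h2, hd.2 _ ((hinc e y).1 hy) (hι.ne hyx), hd.2 _ ((hinc e z).1 hz) (hι.ne hzx)]
  have hstar : ∀ x Φ c, IsColoringOff P H L (ι x) Φ →
      (H.colorStar Φ (ι x) c).ncard = if c ∈ L (ι x) then dMin P else 0 := by
    intro x Φ c h1
    obtain ⟨ha, hb⟩ := h1.low_colorStar hP hcrit.2 (hlow x)
    split_ifs with hc
    · exact ha c hc
    · rw [Set.ncard_eq_zero (Set.toFinite _), Set.eq_empty_iff_forall_notMem]
      intro e he
      obtain ⟨d, hd, hed⟩ := hb e he.1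
      exact hc (colorStar_disjoint he hed ▸ hd)
  -- By `hfull`, an edge at `ι x` that is not in `K` has all its other ends outside `K`, where
  -- colours are frozen.
  have houter : ∀ x Φ c, (∀ v ∉ Set.range ι, Φ v = Φ₀ v) →
      H.colorStar Φ (ι x) c \ Set.range κ = H.colorStar Φ₀ (ι x) c \ Set.range κ := by
    have key : ∀ x (Φ Ψ : H.V → C) (c : C), (∀ v ∉ Set.range ι, Φ v = Ψ v) →
        H.colorStar Φ (ι x) c \ Set.range κ ⊆ H.colorStar Ψ (ι x) c \ Set.range κ := by
      rintro x Φ Ψ c hΦ e ⟨⟨hx, he⟩, hκe⟩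
      refine ⟨⟨hx, fun v hv hvx => ?_⟩, hκe⟩
      rw [← hΦ, he v hv hvx]
      rintro ⟨y, rfl⟩
      exact hκe (hfull e x y (fun h => hvx (h ▸ rfl)) hx hv)
    exact fun x Φ c hΦ => (key x Φ Φ₀ c hΦ).antisymm (key x Φ₀ Φ c fun v hv => (hΦ v hv).symm)
  have hcount : ∀ x φ ψ c, S x φ → S x ψ →
      (K.colorStar φ x c).ncard = (K.colorStar ψ x c).ncard := by
    rintro x φ ψ c ⟨Φ, h1, h2, h3⟩ ⟨Ψ, k1, k2, k3⟩
    have e1 := Set.ncard_inter_add_ncard_sdiff_eq_ncard (H.colorStar Φ (ι x) c) (Set.range κ)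
      (Set.toFinite _)
    have e2 := Set.ncard_inter_add_ncard_sdiff_eq_ncard (H.colorStar Ψ (ι x) c) (Set.range κ)
      (Set.toFinite _)
    rw [houter x Φ c h3, hstar x Φ c h1, ← himage x φ Φ c h1 h2,
      Set.ncard_image_of_injective _ hκ] at e1
    rw [houter x Ψ c k3, hstar x Ψ c k1, ← himage x ψ Ψ c k1 k2,
      Set.ncard_image_of_injective _ hκ] at e2
    omega
  by_cases htwo : ∃ x φ y z, S x φ ∧ y ≠ x ∧ z ≠ x ∧ φ y ≠ φ z
  · obtain ⟨x, φ, y, z, h, hy, hz, hyz⟩ := htwo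
    exact Or.inl (isBrick_of_isSliding hG hS hmono hcount h hy hz hyz)
  right
  intro x
  push Not at htwo
  obtain ⟨φ, hφ⟩ := hS.exists_position hG.1 h₀ x
  obtain ⟨y, hyx⟩ := exists_ne x
  -- With one colour off the hole, all edges of `K` at `x` fall into a single star, of size at most
  -- `dMin P`.
  have hsub : {e | x ∈ K.inc e} ⊆ K.colorStar φ x (φ y) := fun e he =>
    ⟨he, fun z _ hz => htwo x φ z y hφ hz hyx⟩
  obtain ⟨Φ, h1, h2, -⟩ := hφ
  calc K.degree x ≤ (K.colorStar φ x (φ y)).ncard := Set.ncard_le_ncard hsub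
    _ = (κ '' K.colorStar φ x (φ y)).ncard := (Set.ncard_image_of_injective _ hκ).symm
    _ ≤ (H.colorStar Φ (ι x) (φ y)).ncard := by
      rw [himage x φ Φ _ h1 h2]
      exact Set.ncard_le_ncard Set.inter_subset_left
    _ ≤ dMin P := by
      rw [hstar x Φ _ h1]
      split_ifs <;> simp

/-- A connected hypergraph of maximum degree at most `d(P)` outside of `P` is a regular member of
`F(P)`. -/
theorem IsSmooth.minForbidden_of_degree_le (hP : IsSmooth P) (hne : Nonempty H.V)
    (hG : H.adjGraph.Preconnected) (hdeg : ∀ x, H.degree x ≤ dMin P) (hnot : ¬ P H) :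
    MinForbidden P H ∧ H.IsRegular (dMin P) := by
  have key : ∀ A, ¬ P (H.induce A) → A = Set.univ ∧ ∀ x, H.degree x = dMin P := by
    intro A hA
    obtain ⟨Z, hZA, hZ, hd⟩ := hP.exists_subset_not hA
    obtain ⟨z, hz⟩ : Z.Nonempty := by
      by_contra hemp
      rw [Set.not_nonempty_iff_eq_empty] at hemp
      exact hZ (hemp ▸ hP.induce_empty)
    have hle : ∀ x, {e | x ∈ H.inc e ∧ H.inc e ⊆ Z}.ncard ≤ H.degree x := fun x =>
      Set.ncard_le_ncard fun e he => he.1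
    -- A vertex of `Z` has at least `dMin P` edges inside `Z` and at most that many overall, so no
    -- edge leaves `Z`.
    have huniv : ∀ x, x ∈ Z := by
      refine hG.mem_of_closed hz ?_
      rintro x hx y ⟨-, e, hxe, hye⟩
      have heq : {e | x ∈ H.inc e ∧ H.inc e ⊆ Z} = {e | x ∈ H.inc e} :=
        Set.eq_of_subset_of_ncard_le (fun e he => he.1) ((hdeg x).trans (hd x hx))
      have : e ∈ {e | x ∈ H.inc e} := hxe
      rw [← heq] at this
      exact this.2 hye
    exact ⟨Set.eq_univ_of_forall fun x => hZA (huniv x),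
      fun x => (hdeg x).antisymm ((hd x (huniv x)).trans (hle x))⟩
  refine ⟨⟨hnot, fun x => ?_⟩, hne, (key Set.univ (mt hP.induce_univ_iff.1 hnot)).2⟩
  by_contra hx
  have : x ∈ ({x}ᶜ : Set H.V) := by
    rw [(key _ hx).1]
    exact Set.mem_univ x
  exact this rfl

end FinHypergraph

theorem theorem1p3 (P : FinHypergraph.{u, v} → Prop) (hP : FinHypergraph.IsSmooth P)
    (r : ℕ) (hr : FinHypergraph.dMin P = r)
    (H : FinHypergraph.{u, v}) (hH : Nonempty H.V)
    {C : Type w} (L : H.V → Set C) (hcrit : FinHypergraph.Critical P H L)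
    (hF : Nonempty (FinHypergraph.lowHypergraph P H L).V)
    (B : (FinHypergraph.lowHypergraph P H L).Sub)
    (hB : (FinHypergraph.lowHypergraph P H L).IsBlock B) :
    B.coe.IsBrick ∨
      (FinHypergraph.MinForbidden P B.coe ∧ B.coe.IsRegular r) ∨
      (P B.coe ∧ B.coe.maxDegree ≤ r) := by
  subst hr
  obtain ⟨hne, hG⟩ := FinHypergraph.noCut_iff.1 hB.prop
  let lowVal : (FinHypergraph.lowHypergraph P H L).V → H.V :=
    (Subtype.val : FinHypergraph.lowVerts P H L → H.V)
  have hlowVal : Function.Injective lowVal := Subtype.val_injective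
  let lowEdge : (FinHypergraph.lowHypergraph P H L).E → H.E :=
    (Subtype.val : {e : H.E | 2 ≤ (H.inc e ∩ FinHypergraph.lowVerts P H L).ncard} → H.E)
  have hlowEdge : Function.Injective lowEdge := Subtype.val_injective
  rcases hcrit.isBrick_or_degree_le hP (K := B.coe)
    (ι := fun x : B.verts => lowVal x.1) (hlowVal.comp Subtype.val_injective)
    (κ := fun e : B.edges => lowEdge e.1) (hlowEdge.comp Subtype.val_injective)
    (fun _ _ => Iff.rfl)
    (by
      intro e x y hxy hx hy
      have hne : lowVal x.1 ≠ lowVal y.1 := hlowVal.ne (Subtype.val_injective.ne hxy)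
      -- Two low ends make `e` survive shrinking; maximality of the block then puts it into `B`.
      have he : 2 ≤ (H.inc e ∩ FinHypergraph.lowVerts P H L).ncard := by
        rw [← Set.ncard_pair hne]
        refine Set.ncard_le_ncard ?_
        rintro _ (rfl | rfl)
        · exact ⟨hx, x.1.2⟩
        · exact ⟨hy, y.1.2⟩
      have hmem := hB.mem_edges (e := ⟨e, he⟩) (Subtype.val_injective.ne hxy) x.2 y.2 hx hy
      exact ⟨⟨_, hmem⟩, rfl⟩)
    (fun x => x.1.2) hG with h | h
  · exact Or.inl h
  · by_cases hPB : P B.coe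
    · exact Or.inr (Or.inr ⟨hPB, ciSup_le h⟩)
    · exact Or.inr (Or.inl (hP.minForbidden_of_degree_le hne hG.1 h hPB))
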